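/- All algebras are over $\mathbb{C}$. A Leibniz algebra is a vector space $L$ with a bilinear bracket satisfying $[x,[y,z]]=[[x,y],z]-[[x,z],y]$. Put $L^1=L$, $L^{k+1}=[L^k,L]$; $L$ is nilpotent if $L^s=0$ for some $s$, and a nilpotent $L$ is naturally graded if it is isomorphic to $\operatorname{gr}L=\bigoplus_{i\ge1}L^i/L^{i+1}$ with the induced bracket. Let $R_x\colon y\mapsto[y,x]$ and $R(L)=\{x\in L:[y,x]=0\text{ for all }y\in L\}$. The characteristic sequence of $L$ is the lexicographic maximum, over $x\in L\setminus L^2$, of the decreasing sequences of sizes of the Jordan blocks of $R_x$. An $n$-dimensional naturally graded Leibniz algebra with characteristic sequence $(n-3,3)$ is of the first type if it has a basis $e_1,\dots,e_n$ with $e_1\notin L^2$ and $R_{e_1}=\operatorname{diag}(J_{n-3},J_3)$, that is, $[e_i,e_1]=e_{i+1}$ for $1\le i\le n-1$, $i\ne n-3$, and $[e_{n-3},e_1]=[e_n,e_1]=0$. **Theorem.** Let $n\ge 9$. Every $n$-dimensional naturally graded Leibniz algebra $L$ of the first type is isomorphic to one of the following algebras with basis $e_1,\dots,e_n$; each of these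 is a naturally graded Leibniz algebra of the first type, and they are pairwise non-isomorphic (for different families, and for different parameter values within a family). In all of them $[e_i,e_1]=e_{i+1}$ for $1\le i\le n-1$, $i\neq n-3$; the other nonzero products are contained in the following lists. - $L^{34}_{(0,\lambda,0)}$, $\lambda\in\mathbb{C}$: $[e_1,e_{n-2}]=\lambda e_{n-1}$, $[e_2,e_{n-2}]=\lambda e_n$. - $L^{35}_{(\mu,\lambda,1)}$, $\lambda,\mu\in\{0,1\}$: $[e_1,e_{n-2}]=\mu e_2+\lambda e_{n-1}$, $[e_2,e_{n-2}]=\mu e_3+\lambda e_n$, $[e_i,e_{n-2}]=\mu e_{i+1}$ $(3\le i\le n-4)$, $[e_i,e_{n-2}]=e_{i+1}$ $(n-2\le i\le n-1)$. - $L^{36}_{(1,\lambda,0)}$, $\lambda\in\{-1,0\}$: $[e_1,e_{n-2}]=e_2+\lambda e_{n-1}$, $[e_2,e_{n-2}]=e_3+\lambda e_n$, $[e_i,e_{n-2}]=e_{i+1}$ $(3\le i\le n-4)$. - $L^{37}_{(1,\lambda,2)}$, $\lambda\in\mathbb{C}$: $[e_1,e_{n-2}]=e_2+\lambda e_{n-1}$,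 $[e_2,e_{n-2}]=e_3+\lambda e_n$, $[e_i,e_{n-2}]=e_{i+1}$ $(3\le i\le n-4)$, $[e_i,e_{n-2}]=2e_{i+1}$ $(n-2\le i\le n-1)$. - $L^{38}_{(0,0,\lambda)}$, $\lambda\in\mathbb{C}\setminus\{0\}$: $[e_1,e_{n-2}]=-e_{n-1}$, $[e_2,e_{n-2}]=-(1+\lambda)e_n$, $[e_1,e_{n-1}]=\lambda e_n$. - $L^{39}_{(0,1,\lambda)}$, $\lambda\in\{-1,0\}$: $[e_1,e_{n-2}]=-e_{n-1}$, $[e_2,e_{n-2}]=-(1+\lambda)e_n$, $[e_{n-1},e_{n-2}]=-e_n$, $[e_1,e_{n-1}]=\lambda e_n$, $[e_{n-2},e_{n-1}]=e_n$. - $L^{40}_{(1,\lambda,\mu)}$, $\lambda\in\{0,1\}$, $\mu\in\mathbb{C}$, $(\lambda,\mu)\ne(0,0)$: $[e_1,e_{n-2}]=e_2-e_{n-1}$, $[e_2,e_{n-2}]=e_3-(1+\mu)e_n$, $[e_i,e_{n-2}]=e_{i+1}$ $(3\le i\le n-4)$, $[e_{n-1},e_{n-2}]=-\lambda e_n$,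 $[e_1,e_{n-1}]=\mu e_n$, $[e_{n-2},e_{n-1}]=\lambda e_n$. - $L^{41}_{(1,-1,\lambda)}$, $\lambda\in\{-1,0\}$: $[e_1,e_{n-2}]=e_2-e_{n-1}$, $[e_2,e_{n-2}]=e_3-(1+\lambda)e_n$, $[e_i,e_{n-2}]=e_{i+1}$ $(3\le i\le n-4)$, $[e_{n-1},e_{n-2}]=e_n$, $[e_1,e_{n-1}]=\lambda e_n$, $[e_{n-2},e_{n-1}]=-e_n$. Moreover, $e_n\in R(L)$ for every basis $e_1,\dots,e_n$ as in the definition of the first type. -/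

import Mathlib

noncomputable section

namespace NatGradedLeibniz

/-! An algebra structure on a complex vector space `L` is a bilinear map
`b : L →ₗ[ℂ] L →ₗ[ℂ] L`, and `b x y` is the bracket `[x, y]`. -/

section General

variable {L : Type*} [AddCommGroup L] [Module ℂ L]

/-- The (right) Leibniz identity `[x, [y, z]] = [[x, y], z] - [[x, z], y]`. -/
def IsLeibniz (b : L →ₗ[ℂ] L →ₗ[ℂ] L) : Prop :=
  ∀ x y z : L, b x (b y z) = b (b x y) z - b (b x z) y

/-- Isomorphism of algebras. -/
def Isomorphic {V W : Type*} [AddCommMonoid V] [Module ℂ V] [AddCommMonoid W] [Module ℂ W]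
    (b : V →ₗ[ℂ] V →ₗ[ℂ] V) (b' : W →ₗ[ℂ] W →ₗ[ℂ] W) : Prop :=
  ∃ φ : V ≃ₗ[ℂ] W, ∀ x y : V, φ (b x y) = b' (φ x) (φ y)

/-- The descending central series `L¹ = L`, `L^(k+1) = [L^k, L]`, with the index shifted by one:
`lcs b k` is `L^(k+1)`. -/
def lcs (b : L →ₗ[ℂ] L →ₗ[ℂ] L) : ℕ → Submodule ℂ L
  | 0 => ⊤
  | k + 1 => Submodule.map₂ b (lcs b k) ⊤

/-- The derived subalgebra `L² = [L, L]`. -/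
abbrev derived (b : L →ₗ[ℂ] L →ₗ[ℂ] L) : Submodule ℂ L := lcs b 1

/-- Nilpotency: some term of the descending central series vanishes. -/
def IsNilpotentAlg (b : L →ₗ[ℂ] L →ₗ[ℂ] L) : Prop := ∃ s : ℕ, lcs b s = ⊥

/-- The right annihilator `R(L) = {x | [y, x] = 0 for all y}`. -/
def rightAnnihilator (b : L →ₗ[ℂ] L →ₗ[ℂ] L) : Set L := {x | ∀ y : L, b y x = 0}

/-- The operator of right multiplication `R_x : y ↦ [y, x]`. -/
def rightMul (b : L →ₗ[ℂ] L →ₗ[ℂ] L) (x : L) : L →ₗ[ℂ] L := b.flip x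

/-! ### The associated graded algebra -/

theorem lcs_succ_le (b : L →ₗ[ℂ] L →ₗ[ℂ] L) (k : ℕ) : lcs b (k + 1) ≤ lcs b k := by
  induction k with
  | zero => exact le_top
  | succ k ih => exact Submodule.map₂_le_map₂ ih le_rfl

/-- `[L^i, L^j] ⊆ L^(i+j)`. -/
theorem bracket_mem_lcs {b : L →ₗ[ℂ] L →ₗ[ℂ] L} (hb : IsLeibniz b) (j : ℕ) :
    ∀ (i : ℕ) {x y : L}, x ∈ lcs b i → y ∈ lcs b j → b x y ∈ lcs b (i + j + 1) := by
  induction j with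
  | zero =>
    intro i x y hx _
    exact Submodule.apply_mem_map₂ b hx Submodule.mem_top
  | succ j ih =>
    intro i x y hx hy
    have key : lcs b (j + 1) ≤ (lcs b (i + (j + 1) + 1)).comap (b x) := by
      refine Submodule.map₂_le.2 fun y hy z _ => ?_
      rw [Submodule.mem_comap, hb x y z]
      refine Submodule.sub_mem _ ?_ ?_
      · exact Submodule.apply_mem_map₂ b (ih i hx hy) Submodule.mem_top
      · have hxz : b x z ∈ lcs b (i + 1) := Submodule.apply_mem_map₂ b hx Submodule.mem_top
        have h := ih (i + 1) hxz hy
        rwa [show i + 1 + j + 1 = i + (j + 1) + 1 by omega] at h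
    exact key hy

/-- The homogeneous component `L^(i+1) / L^(i+2)` of the associated graded algebra. -/
abbrev grPiece (b : L →ₗ[ℂ] L →ₗ[ℂ] L) (i : ℕ) : Type _ :=
  lcs b i ⧸ (lcs b (i + 1)).submoduleOf (lcs b i)

/-- The product `L^(i+1) × L^(j+1) → L^(i+j+2) / L^(i+j+3)` induced by the bracket. -/
def grPair (b : L →ₗ[ℂ] L →ₗ[ℂ] L) (hb : IsLeibniz b) (i j : ℕ) :
    lcs b i →ₗ[ℂ] lcs b j →ₗ[ℂ] grPiece b (i + j + 1) :=
  LinearMap.mk₂ ℂ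
    (fun x y => Submodule.Quotient.mk ⟨b x y, bracket_mem_lcs hb j i x.2 y.2⟩)
    (fun x x' y => by
      rw [← Submodule.Quotient.mk_add]; congr 1; ext; simp)
    (fun c x y => by
      rw [← Submodule.Quotient.mk_smul]; congr 1; ext; simp)
    (fun x y y' => by
      rw [← Submodule.Quotient.mk_add]; congr 1; ext; simp)
    (fun c x y => by
      rw [← Submodule.Quotient.mk_smul]; congr 1; ext; simp)

/-- The bracket of two homogeneous components of the associated graded algebra. -/
def grComponent (b : L →ₗ[ℂ] L →ₗ[ℂ] L) (hb : IsLeibniz b) (i j : ℕ) :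
    grPiece b i →ₗ[ℂ] grPiece b j →ₗ[ℂ] grPiece b (i + j + 1) :=
  (grPair b hb i j).liftQ₂ _ _
    (by
      intro x hx
      rw [LinearMap.mem_ker]
      ext y
      refine (Submodule.Quotient.mk_eq_zero _).2 ?_
      have h := bracket_mem_lcs hb j (i + 1) (Submodule.mem_comap.1 hx) y.2
      rw [show i + 1 + j + 1 = i + j + 1 + 1 by omega] at h
      exact h)
    (by
      intro y hy
      rw [LinearMap.mem_ker]
      ext x
      refine (Submodule.Quotient.mk_eq_zero _).2 ?_
      exact bracket_mem_lcs hb (j + 1) i x.2 (Submodule.mem_comap.1 hy))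

/-- The underlying space of the associated graded algebra `gr L = ⨁ L^i / L^(i+1)`. For nilpotent
`L` all but finitely many summands vanish. -/
abbrev Gr (b : L →ₗ[ℂ] L →ₗ[ℂ] L) : Type _ := DirectSum ℕ (grPiece b)

/-- The bracket of the associated graded algebra. -/
def grBracket (b : L →ₗ[ℂ] L →ₗ[ℂ] L) (hb : IsLeibniz b) : Gr b →ₗ[ℂ] Gr b →ₗ[ℂ] Gr b :=
  DirectSum.toModule ℂ ℕ _ fun i =>
    (DirectSum.toModule ℂ ℕ (grPiece b i →ₗ[ℂ] Gr b) fun j =>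
      ((grComponent b hb i j).compr₂ (DirectSum.lof ℂ ℕ (grPiece b) (i + j + 1))).flip).flip

/-- A naturally graded Leibniz algebra: a nilpotent Leibniz algebra isomorphic to its associated
graded algebra. -/
def IsNaturallyGraded (b : L →ₗ[ℂ] L →ₗ[ℂ] L) : Prop :=
  ∃ hb : IsLeibniz b, IsNilpotentAlg b ∧ Isomorphic b (grBracket b hb)

/-! ### Characteristic sequence and algebras of the first type -/

/-- `T` is nilpotent and `l` is the decreasing sequence of the sizes of its Jordan blocks: there is
a basis made of one chain `v₁ ↦ v₂ ↦ ⋯ ↦ v_m ↦ 0` for each entry `m` of `l`. -/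
def HasJordanSizes (T : L →ₗ[ℂ] L) (l : List ℕ) : Prop :=
  l.Pairwise (· ≥ ·) ∧ 0 ∉ l ∧
    ∃ v : Module.Basis (Σ k : Fin l.length, Fin (l.get k)) ℂ L,
      ∀ (k : Fin l.length) (i : Fin (l.get k)),
        T (v ⟨k, i⟩) = if h : (i : ℕ) + 1 < l.get k then v ⟨k, ⟨i + 1, h⟩⟩ else 0

/-- `l` is the characteristic sequence of the algebra: the lexicographic maximum, over
`x ∈ L \ L²`, of the sequences of Jordan block sizes of the operators `R_x`. -/
def IsCharacteristicSequence (b : L →ₗ[ℂ] L →ₗ[ℂ] L) (l : List ℕ) : Prop :=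
  (∃ x : L, x ∉ derived b ∧ HasJordanSizes (rightMul b x) l) ∧
    ∀ (y : L) (m : List ℕ), y ∉ derived b → HasJordanSizes (rightMul b y) m → m ≤ l

/-- The basis vector `e_k` in the numbering `e_1, …, e_n`; zero if `k` is not in `{1, …, n}`. -/
def vec {n : ℕ} (e : Module.Basis (Fin n) ℂ L) (k : ℕ) : L :=
  if h : 1 ≤ k ∧ k ≤ n then e ⟨k - 1, by omega⟩ else 0

/-- `e_1 ∉ L²` and in the basis `e_1, …, e_n` the operator `R_{e_1}` is
`diag(J_{n-3}, J_3)`, with `e_1, …, e_{n-3}` and `e_{n-2}, e_{n-1}, e_n` as Jordan chains. -/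
def IsFirstTypeBasis (b : L →ₗ[ℂ] L →ₗ[ℂ] L) {n : ℕ} (e : Module.Basis (Fin n) ℂ L) : Prop :=
  vec e 1 ∉ derived b ∧
    ∀ i : ℕ, 1 ≤ i → i ≤ n →
      rightMul b (vec e 1) (vec e i) = if i = n - 3 ∨ i = n then 0 else vec e (i + 1)

/-- A naturally graded Leibniz algebra of dimension `n` with characteristic sequence `(n-3, 3)`,
of the first type. -/
def IsFirstType (n : ℕ) (b : L →ₗ[ℂ] L →ₗ[ℂ] L) : Prop :=
  IsNaturallyGraded b ∧ IsCharacteristicSequence b [n - 3, 3] ∧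
    ∃ e : Module.Basis (Fin n) ℂ L, IsFirstTypeBasis b e

end General

/-! ### The multiplication tables -/

/-- The standard basis vector `e_k` of `ℂⁿ`, in the numbering `e_1, …, e_n`. -/
def E (n k : ℕ) : Fin n → ℂ := vec (Pi.basisFun ℂ (Fin n)) k

/-- The algebra on `ℂⁿ` with products `[e_i, e_j] = t i j`, `1 ≤ i, j ≤ n`. -/
def ofTable (n : ℕ) (t : ℕ → ℕ → (Fin n → ℂ)) :
    (Fin n → ℂ) →ₗ[ℂ] (Fin n → ℂ) →ₗ[ℂ] (Fin n → ℂ) :=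
  (Pi.basisFun ℂ (Fin n)).constr ℂ fun i =>
    (Pi.basisFun ℂ (Fin n)).constr ℂ fun j => t (i + 1) (j + 1)

def L34 (n : ℕ) (l : ℂ) := ofTable n fun i j =>
  if j = 1 ∧ i ≤ n - 1 ∧ i ≠ n - 3 then E n (i + 1)
  else if i = 1 ∧ j = n - 2 then l • E n (n - 1)
  else if i = 2 ∧ j = n - 2 then l • E n n
  else 0

def L35 (n : ℕ) (m l : ℂ) := ofTable n fun i j =>
  if j = 1 ∧ i ≤ n - 1 ∧ i ≠ n - 3 then E n (i + 1)
  else if i = 1 ∧ j = n - 2 then m • E n 2 + l • E n (n - 1)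
  else if i = 2 ∧ j = n - 2 then m • E n 3 + l • E n n
  else if 3 ≤ i ∧ i ≤ n - 4 ∧ j = n - 2 then m • E n (i + 1)
  else if n - 2 ≤ i ∧ i ≤ n - 1 ∧ j = n - 2 then E n (i + 1)
  else 0

def L36 (n : ℕ) (l : ℂ) := ofTable n fun i j =>
  if j = 1 ∧ i ≤ n - 1 ∧ i ≠ n - 3 then E n (i + 1)
  else if i = 1 ∧ j = n - 2 then E n 2 + l • E n (n - 1)
  else if i = 2 ∧ j = n - 2 then E n 3 + l • E n n
  else if 3 ≤ i ∧ i ≤ n - 4 ∧ j = n - 2 then E n (i + 1)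
  else 0

def L37 (n : ℕ) (l : ℂ) := ofTable n fun i j =>
  if j = 1 ∧ i ≤ n - 1 ∧ i ≠ n - 3 then E n (i + 1)
  else if i = 1 ∧ j = n - 2 then E n 2 + l • E n (n - 1)
  else if i = 2 ∧ j = n - 2 then E n 3 + l • E n n
  else if 3 ≤ i ∧ i ≤ n - 4 ∧ j = n - 2 then E n (i + 1)
  else if n - 2 ≤ i ∧ i ≤ n - 1 ∧ j = n - 2 then (2 : ℂ) • E n (i + 1)
  else 0

def L38 (n : ℕ) (l : ℂ) := ofTable n fun i j =>
  if j = 1 ∧ i ≤ n - 1 ∧ i ≠ n - 3 then E n (i + 1)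
  else if i = 1 ∧ j = n - 2 then -E n (n - 1)
  else if i = 2 ∧ j = n - 2 then -(1 + l) • E n n
  else if i = 1 ∧ j = n - 1 then l • E n n
  else 0

def L39 (n : ℕ) (l : ℂ) := ofTable n fun i j =>
  if j = 1 ∧ i ≤ n - 1 ∧ i ≠ n - 3 then E n (i + 1)
  else if i = 1 ∧ j = n - 2 then -E n (n - 1)
  else if i = 2 ∧ j = n - 2 then -(1 + l) • E n n
  else if i = n - 1 ∧ j = n - 2 then -E n n
  else if i = 1 ∧ j = n - 1 then l • E n n
  else if i = n - 2 ∧ j = n - 1 then E n n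
  else 0

def L40 (n : ℕ) (l m : ℂ) := ofTable n fun i j =>
  if j = 1 ∧ i ≤ n - 1 ∧ i ≠ n - 3 then E n (i + 1)
  else if i = 1 ∧ j = n - 2 then E n 2 - E n (n - 1)
  else if i = 2 ∧ j = n - 2 then E n 3 - (1 + m) • E n n
  else if 3 ≤ i ∧ i ≤ n - 4 ∧ j = n - 2 then E n (i + 1)
  else if i = n - 1 ∧ j = n - 2 then -l • E n n
  else if i = 1 ∧ j = n - 1 then m • E n n
  else if i = n - 2 ∧ j = n - 1 then l • E n n
  else 0

def L41 (n : ℕ) (l : ℂ) := ofTable n fun i j =>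
  if j = 1 ∧ i ≤ n - 1 ∧ i ≠ n - 3 then E n (i + 1)
  else if i = 1 ∧ j = n - 2 then E n 2 - E n (n - 1)
  else if i = 2 ∧ j = n - 2 then E n 3 - (1 + l) • E n n
  else if 3 ≤ i ∧ i ≤ n - 4 ∧ j = n - 2 then E n (i + 1)
  else if i = n - 1 ∧ j = n - 2 then E n n
  else if i = 1 ∧ j = n - 1 then l • E n n
  else if i = n - 2 ∧ j = n - 1 then -E n n
  else 0

/-- Names of the members of the eight families, with their parameters: `a34 l` is
`L³⁴_(0,l,0)`, `a35 m l` is `L³⁵_(m,l,1)`, `a36 l` is `L³⁶_(1,l,0)`, `a37 l` is `L³⁷_(1,l,2)`,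
`a38 l` is `L³⁸_(0,0,l)`, `a39 l` is `L³⁹_(0,1,l)`, `a40 l m` is `L⁴⁰_(1,l,m)` and
`a41 l` is `L⁴¹_(1,-1,l)`. -/
inductive Label : Type
  | a34 (l : ℂ)
  | a35 (m l : ℂ)
  | a36 (l : ℂ)
  | a37 (l : ℂ)
  | a38 (l : ℂ)
  | a39 (l : ℂ)
  | a40 (l m : ℂ)
  | a41 (l : ℂ)

/-- The ranges of the parameters. The values `l = 0` for `a38` and `(l, m) = (0, 0)` for `a40` are
excluded: there the tables are those of `a34 (-1)` and `a36 (-1)`. -/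
def Label.Admissible : Label → Prop
  | .a34 _ => True
  | .a35 m l => (m = 0 ∨ m = 1) ∧ (l = 0 ∨ l = 1)
  | .a36 l => l = -1 ∨ l = 0
  | .a37 _ => True
  | .a38 l => l ≠ 0
  | .a39 l => l = -1 ∨ l = 0
  | .a40 l m => (l = 0 ∧ m ≠ 0) ∨ l = 1
  | .a41 l => l = -1 ∨ l = 0

/-- The `n`-dimensional algebra with a given name. -/
def Label.algebra (n : ℕ) : Label → ((Fin n → ℂ) →ₗ[ℂ] (Fin n → ℂ) →ₗ[ℂ] (Fin n → ℂ))
  | .a34 l => L34 n l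
  | .a35 m l => L35 n m l
  | .a36 l => L36 n l
  | .a37 l => L37 n l
  | .a38 l => L38 n l
  | .a39 l => L39 n l
  | .a40 l m => L40 n l m
  | .a41 l => L41 n l

end NatGradedLeibniz

end

open NatGradedLeibniz

noncomputable section

/-! ### Structure constants and model algebras -/

namespace NatGradedLeibniz

/-! Write `x = e_1`, `f = e_{n-2}`, `f₂ = [f, x]`, `f₃ = [f₂, x]`. The classification reduces to
five constants: `[x, f] = α[x, x] + β f₂`, `[f, f] = δ f₂`, `[x, f₂] = ν f₃`, `[f, f₂] = σ f₃`.
Together with the two `R_x`-chains and `f₃ ∈ R(L)`, these relations determine the whole table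
(`Presentation.isomorphic_model`), and constants with `δν = δσ = (β+1)ν = (β+1)σ = 0` define a
naturally graded algebra of the first type (`isFirstType_model`).

To reach these relations from an abstract algebra, transport the degree derivation of `gr L` to `L`:
it gives a derivation `D` acting on `L^k / L^(k+1)` as `k`. After an inner derivation is added, `D
e_1 - e_1` lies in `R(L)`, so `e_1` can be corrected to a `D`-fixed vector `x` with `R_x = R_{e_1}`.
The Jordan structure of `R_{e_1}` is thus kept, and `x` has a `D`-fixed partner `f`. Weights leave
few unknown coefficients in the brackets of `x` and `f` with `f`, `f₂`, `f₃`. Comparing Leibniz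
identities along the chains (`exists_presentation`) kills all but the five above and puts `f₃` in
`R(L)`; the bound on `n` makes the long chain long enough for these comparisons.

An isomorphism between two models can only send the generators, modulo `L²` and a common scalar, to
`x + s f` and `d f`: a component of `f` along `x` would make the short chain too long
(`related_of_isomorphic`). Conversely every such change with nonvanishing factors is allowed
(`change_generators`). Where the constants are nonzero it acts by `1/α ↦ (1/α + s)/d`, `1/δ ↦ (1/δ +
s)/d`, `1/σ ↦ (1/σ - s)/d` (here `δ = 0`). So the vanishing of `α`, `δ`, `σ` and, among nonzero
constants, the equalities `α = δ` and `α = -σ` are invariant. These, with the action on `β` and `ν`,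
separate the families, and the freedom in `s` and `d` gives the normal forms (`exists_label`). -/

/-- Structure constants of a homogeneous algebra of the first type. -/
structure Params where
  α : ℂ
  β : ℂ
  δ : ℂ
  ν : ℂ
  σ : ℂ

/-- The relations among the structure constants forced by the Leibniz identity. -/
structure Params.Good (P : Params) : Prop where
  δν : P.δ * P.ν = 0
  δσ : P.δ * P.σ = 0
  βν : (P.β + 1) * P.ν = 0
  βσ : (P.β + 1) * P.σ = 0

/-- The multiplication table with given structure constants. -/
def modelTable (n : ℕ) (P : Params) (i j : ℕ) : Fin n → ℂ :=
  if j = 1 ∧ i ≤ n - 1 ∧ i ≠ n - 3 then E n (i + 1)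
  else if i = 1 ∧ j = n - 2 then P.α • E n 2 + P.β • E n (n - 1)
  else if i = 2 ∧ j = n - 2 then P.α • E n 3 + (P.β - P.ν) • E n n
  else if 3 ≤ i ∧ i ≤ n - 4 ∧ j = n - 2 then P.α • E n (i + 1)
  else if i = n - 2 ∧ j = n - 2 then P.δ • E n (n - 1)
  else if i = n - 1 ∧ j = n - 2 then (P.δ - P.σ) • E n n
  else if i = 1 ∧ j = n - 1 then P.ν • E n n
  else if i = n - 2 ∧ j = n - 1 then P.σ • E n n
  else 0

/-- The algebra with given structure constants. -/
def model (n : ℕ) (P : Params) := ofTable n (modelTable n P)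

/-- The structure constants of the listed algebras. -/
def Label.params : Label → Params
  | .a34 l => ⟨0, l, 0, 0, 0⟩
  | .a35 m l => ⟨m, l, 1, 0, 0⟩
  | .a36 l => ⟨1, l, 0, 0, 0⟩
  | .a37 l => ⟨1, l, 2, 0, 0⟩
  | .a38 l => ⟨0, -1, 0, l, 0⟩
  | .a39 l => ⟨0, -1, 0, l, 1⟩
  | .a40 l m => ⟨1, -1, 0, m, l⟩
  | .a41 l => ⟨1, -1, 0, l, -1⟩

theorem Label.good_params (p : Label) : p.params.Good := by
  cases p <;> constructor <;> simp [Label.params]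

theorem ofTable_congr {n : ℕ} {t t' : ℕ → ℕ → (Fin n → ℂ)}
    (h : ∀ i j, 1 ≤ i → i ≤ n → 1 ≤ j → j ≤ n → t i j = t' i j) : ofTable n t = ofTable n t' := by
  unfold ofTable
  congr 1
  funext i
  congr 1
  funext j
  exact h _ _ (by omega) (by omega) (by omega) (by omega)

set_option maxHeartbeats 4000000 in
theorem Label.algebra_eq_model {n : ℕ} (hn : 9 ≤ n) (p : Label) :
    p.algebra n = model n p.params := by
  have h1 : n - 2 + 1 = n - 1 := by omega
  have h2 : n - 1 + 1 = n := by omega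
  cases p <;>
  · simp only [Label.algebra, L34, L35, L36, L37, L38, L39, L40, L41, model]
    refine ofTable_congr fun i j hi hi' hj hj' => ?_
    simp only [modelTable, Label.params]
    split_ifs <;> first
      | (exfalso; omega)
      | rfl
      | (simp only [zero_smul, one_smul, neg_smul, zero_add, sub_zero, zero_sub]; done)
      | (obtain ⟨rfl, rfl⟩ := ‹_ = _ ∧ _ = _›
         simp only [h1, h2, zero_smul, one_smul, zero_add, sub_zero, zero_sub]; done)
      | (obtain ⟨rfl, rfl⟩ := ‹_ = _ ∧ _ = _›; module)

theorem E_eq_single {n k : ℕ} (h : k < n) : E n (k + 1) = Pi.single ⟨k, h⟩ 1 := by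
  unfold E vec
  rw [dif_pos (by omega)]
  simp [Pi.basisFun_apply]

theorem ofTable_E {n : ℕ} (t : ℕ → ℕ → (Fin n → ℂ)) {i j : ℕ} (hi : 1 ≤ i) (hi' : i ≤ n)
    (hj : 1 ≤ j) (hj' : j ≤ n) : ofTable n t (E n i) (E n j) = t i j := by
  unfold ofTable E vec
  rw [dif_pos ⟨hi, hi'⟩, dif_pos ⟨hj, hj'⟩, Module.Basis.constr_basis, Module.Basis.constr_basis]
  congr 1 <;> simp <;> omega

theorem E_ext {n : ℕ} {M : Type*} [AddCommMonoid M] [Module ℂ M] {f g : (Fin n → ℂ) →ₗ[ℂ] M}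
    (h : ∀ i, 1 ≤ i → i ≤ n → f (E n i) = g (E n i)) : f = g := by
  refine (Pi.basisFun ℂ (Fin n)).ext fun i => ?_
  have := h (i + 1) (by omega) (by omega)
  rwa [E_eq_single i.2, ← Pi.basisFun_apply] at this

/-- The coordinate of `e_k`. -/
def X (n k : ℕ) : (Fin n → ℂ) →ₗ[ℂ] ℂ :=
  if h : 1 ≤ k ∧ k ≤ n then LinearMap.proj ⟨k - 1, by omega⟩ else 0

theorem X_E {n i k : ℕ} (hk : 1 ≤ k) (hk' : k ≤ n) (hi : 1 ≤ i) :
    X n k (E n i) = if i = k then 1 else 0 := by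
  unfold X E vec
  rw [dif_pos ⟨hk, hk'⟩]
  split_ifs with h1 h2 h2
  · simp [h2]
  · simp only [Pi.basisFun_apply, LinearMap.proj_apply]
    rw [Pi.single_eq_of_ne]
    simp only [ne_eq, Fin.mk.injEq]; omega
  · omega
  · simp

theorem X_E_self {n k : ℕ} (hk : 1 ≤ k) (hk' : k ≤ n) : X n k (E n k) = 1 := by
  rw [X_E hk hk' hk, if_pos rfl]

theorem X_E_of_eq {n i k : ℕ} (hk : 1 ≤ k) (hk' : k ≤ n) (h : i = k) : X n k (E n i) = 1 := by
  rw [h, X_E_self hk hk']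

theorem X_E_ne {n i k : ℕ} (hk : 1 ≤ k) (hk' : k ≤ n) (hi : 1 ≤ i) (h : i ≠ k) :
    X n k (E n i) = 0 := by
  rw [X_E hk hk' hi, if_neg h]

/-! ### Right multiplications in the model and the Leibniz identity -/

section Operators

variable {n : ℕ} {P : Params}

theorem rightMul_apply {L : Type*} [AddCommGroup L] [Module ℂ L] (b : L →ₗ[ℂ] L →ₗ[ℂ] L)
    (x y : L) : rightMul b x y = b y x := rfl

/-- Right multiplication by `e_1`. -/
def opA (n : ℕ) (P : Params) := rightMul (model n P) (E n 1)
/-- Right multiplication by `e_{n-2}`. -/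
def opB (n : ℕ) (P : Params) := rightMul (model n P) (E n (n - 2))
/-- Right multiplication by `e_{n-1}`. -/
def opC (n : ℕ) (P : Params) := rightMul (model n P) (E n (n - 1))

theorem model_E {i j : ℕ} (hi : 1 ≤ i) (hi' : i ≤ n) (hj : 1 ≤ j) (hj' : j ≤ n) :
    model n P (E n i) (E n j) = modelTable n P i j := ofTable_E _ hi hi' hj hj'

theorem opA_E (hn : 9 ≤ n) {i : ℕ} (hi : 1 ≤ i) (hi' : i ≤ n - 1) (h : i ≠ n - 3) :
    opA n P (E n i) = E n (i + 1) := by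
  rw [opA, rightMul_apply, model_E hi (by omega) le_rfl (by omega), modelTable, if_pos]
  omega

theorem opA_last (hn : 9 ≤ n) {i : ℕ} (h : i = n - 3 ∨ i = n) : opA n P (E n i) = 0 := by
  rw [opA, rightMul_apply, model_E (by omega) (by omega) le_rfl (by omega), modelTable]
  repeat rw [if_neg (by omega)]

theorem opB_one (hn : 9 ≤ n) : opB n P (E n 1) = P.α • E n 2 + P.β • E n (n - 1) := by
  rw [opB, rightMul_apply, model_E (by omega) (by omega) (by omega) (by omega), modelTable,
    if_neg (by omega), if_pos (by omega)]

theorem opB_two (hn : 9 ≤ n) : opB n P (E n 2) = P.α • E n 3 + (P.β - P.ν) • E n n := by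
  rw [opB, rightMul_apply, model_E (by omega) (by omega) (by omega) (by omega), modelTable,
    if_neg (by omega), if_neg (by omega), if_pos (by omega)]

theorem opB_E (hn : 9 ≤ n) {i : ℕ} (hi : 3 ≤ i) (hi' : i ≤ n - 4) :
    opB n P (E n i) = P.α • E n (i + 1) := by
  rw [opB, rightMul_apply, model_E (by omega) (by omega) (by omega) (by omega), modelTable,
    if_neg (by omega), if_neg (by omega), if_neg (by omega), if_pos (by omega)]

theorem opB_f1 (hn : 9 ≤ n) : opB n P (E n (n - 2)) = P.δ • E n (n - 1) := by
  rw [opB, rightMul_apply, model_E (by omega) (by omega) (by omega) (by omega), modelTable,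
    if_neg (by omega), if_neg (by omega), if_neg (by omega), if_neg (by omega), if_pos (by omega)]

theorem opB_f2 (hn : 9 ≤ n) : opB n P (E n (n - 1)) = (P.δ - P.σ) • E n n := by
  rw [opB, rightMul_apply, model_E (by omega) (by omega) (by omega) (by omega), modelTable,
    if_neg (by omega), if_neg (by omega), if_neg (by omega), if_neg (by omega),
    if_neg (by omega), if_pos (by omega)]

theorem opB_last (hn : 9 ≤ n) {i : ℕ} (h : i = n - 3 ∨ i = n) : opB n P (E n i) = 0 := by
  rw [opB, rightMul_apply, model_E (by omega) (by omega) (by omega) (by omega), modelTable]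
  repeat rw [if_neg (by omega)]

theorem opC_one (hn : 9 ≤ n) : opC n P (E n 1) = P.ν • E n n := by
  rw [opC, rightMul_apply, model_E (by omega) (by omega) (by omega) (by omega), modelTable,
    if_neg (by omega), if_neg (by omega), if_neg (by omega), if_neg (by omega),
    if_neg (by omega), if_neg (by omega), if_pos (by omega)]

theorem opC_f1 (hn : 9 ≤ n) : opC n P (E n (n - 2)) = P.σ • E n n := by
  rw [opC, rightMul_apply, model_E (by omega) (by omega) (by omega) (by omega), modelTable,
    if_neg (by omega), if_neg (by omega), if_neg (by omega), if_neg (by omega),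
    if_neg (by omega), if_neg (by omega), if_neg (by omega), if_pos (by omega)]

theorem opC_E (hn : 9 ≤ n) {i : ℕ} (hi : 2 ≤ i) (hi' : i ≤ n) (h : i ≠ n - 2) :
    opC n P (E n i) = 0 := by
  rw [opC, rightMul_apply, model_E (by omega) (by omega) (by omega) (by omega), modelTable]
  repeat rw [if_neg (by omega)]

theorem model_E_right_eq_zero (hn : 9 ≤ n) {j : ℕ} (hj : 1 ≤ j) (hj' : j ≤ n) (h1 : j ≠ 1)
    (h2 : j ≠ n - 2) (h3 : j ≠ n - 1) (v : Fin n → ℂ) : model n P v (E n j) = 0 := by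
  have : rightMul (model n P) (E n j) = 0 := by
    refine E_ext fun i hi hi' => ?_
    rw [rightMul_apply, model_E hi hi' hj hj', modelTable]
    repeat rw [if_neg (by omega)]
    rfl
  exact LinearMap.congr_fun this v

/-- Only `e_1`, `e_{n-2}` and `e_{n-1}` can act nontrivially from the right, so the bracket is
encoded by three operators. -/
theorem model_apply (hn : 9 ≤ n) (v w : Fin n → ℂ) : model n P v w =
    X n 1 w • opA n P v + X n (n - 2) w • opB n P v + X n (n - 1) w • opC n P v := by
  have : model n P v = (X n 1).smulRight (opA n P v) + (X n (n - 2)).smulRight (opB n P v)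
      + (X n (n - 1)).smulRight (opC n P v) := by
    refine E_ext fun j hj hj' => ?_
    simp only [LinearMap.add_apply, LinearMap.smulRight_apply]
    rw [X_E (by omega) (by omega) hj, X_E (by omega) (by omega) hj, X_E (by omega) (by omega) hj]
    by_cases h1 : j = 1
    · rw [if_pos h1, if_neg (by omega), if_neg (by omega)]
      simp [opA, rightMul_apply, h1]
    by_cases h2 : j = n - 2
    · rw [if_neg h1, if_pos h2, if_neg (by omega)]
      simp [opB, rightMul_apply, h2]
    by_cases h3 : j = n - 1
    · rw [if_neg h1, if_neg h2, if_pos h3]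
      simp [opC, rightMul_apply, h3]
    rw [model_E_right_eq_zero hn hj hj' h1 h2 h3]
    simp [h1, h2, h3]
  rw [this]; rfl

/-- Case distinction over the basis vectors according to their role in the table. -/
theorem index_cases (hn : 9 ≤ n) {i : ℕ} (hi : 1 ≤ i) (hi' : i ≤ n) :
    i = 1 ∨ i = 2 ∨ (3 ≤ i ∧ i ≤ n - 5) ∨ i = n - 4 ∨ i = n - 3 ∨ i = n - 2 ∨ i = n - 1 ∨
      i = n := by omega

theorem opC_opA (hn : 9 ≤ n) (v : Fin n → ℂ) : opC n P (opA n P v) = 0 := by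
  have : opC n P ∘ₗ opA n P = 0 := by
    refine E_ext fun i hi hi' => ?_
    rw [LinearMap.comp_apply, LinearMap.zero_apply]
    by_cases h : i = n - 3 ∨ i = n
    · rw [opA_last hn h, map_zero]
    · rw [opA_E hn hi (by omega) (by omega), opC_E hn (by omega) (by omega) (by omega)]
  exact LinearMap.congr_fun this v

theorem opC_opB (hn : 9 ≤ n) (v : Fin n → ℂ) : opC n P (opB n P v) = 0 := by
  have : opC n P ∘ₗ opB n P = 0 := by
    refine E_ext fun i hi hi' => ?_
    rw [LinearMap.comp_apply, LinearMap.zero_apply]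
    rcases index_cases hn hi hi' with rfl | rfl | h | h | rfl | rfl | rfl | h
    · rw [opB_one hn, map_add, map_smul, map_smul, opC_E hn (by omega) (by omega) (by omega),
        opC_E hn (by omega) (by omega) (by omega)]; simp
    · rw [opB_two hn, map_add, map_smul, map_smul, opC_E hn (by omega) (by omega) (by omega),
        opC_E hn (by omega) (by omega) (by omega)]; simp
    · rw [opB_E hn (by omega) (by omega), map_smul, opC_E hn (by omega) (by omega) (by omega)]
      simp
    · rw [opB_E hn (by omega) (by omega), map_smul, opC_E hn (by omega) (by omega) (by omega)]
      simp
    · rw [opB_last hn (by omega), map_zero]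
    · rw [opB_f1 hn, map_smul, opC_E hn (by omega) (by omega) (by omega)]; simp
    · rw [opB_f2 hn, map_smul, opC_E hn (by omega) (by omega) (by omega)]; simp
    · rw [opB_last hn (by omega), map_zero]
  exact LinearMap.congr_fun this v

theorem opC_apply (hn : 9 ≤ n) (v : Fin n → ℂ) :
    opC n P v = (P.ν * X n 1 v + P.σ * X n (n - 2) v) • E n n := by
  have : opC n P = (P.ν • X n 1 + P.σ • X n (n - 2)).smulRight (E n n) := by
    refine E_ext fun i hi hi' => ?_
    simp only [LinearMap.add_apply, LinearMap.smulRight_apply, LinearMap.smul_apply, smul_eq_mul]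
    by_cases h1 : i = 1
    · subst h1
      rw [opC_one hn, X_E_self (by omega) (by omega), X_E_ne (by omega) (by omega) (by omega)
        (by omega)]
      simp
    by_cases h2 : i = n - 2
    · subst h2
      rw [opC_f1 hn, X_E_self (by omega) (by omega), X_E_ne (by omega) (by omega) (by omega)
        (by omega)]
      simp
    rw [opC_E hn (by omega) hi' h2, X_E_ne (by omega) (by omega) (by omega) h1,
      X_E_ne (by omega) (by omega) (by omega) h2]
    simp
  rw [this]; rfl

theorem opA_opC (hn : 9 ≤ n) (v : Fin n → ℂ) : opA n P (opC n P v) = 0 := by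
  rw [opC_apply hn, map_smul, opA_last hn (by omega), smul_zero]

theorem opB_opC (hn : 9 ≤ n) (v : Fin n → ℂ) : opB n P (opC n P v) = 0 := by
  rw [opC_apply hn, map_smul, opB_last hn (by omega), smul_zero]

/-- This commutator is the Leibniz identity for `[v, [e_{n-2}, e_1]]`; it is the reason for the
coefficients `β - ν` and `δ - σ` in the table. -/
theorem opA_opB (hn : 9 ≤ n) (v : Fin n → ℂ) :
    opA n P (opB n P v) = opB n P (opA n P v) + opC n P v := by
  have e1 : n - 2 + 1 = n - 1 := by omega
  have e2 : n - 1 + 1 = n := by omega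
  have e3 : n - 4 + 1 = n - 3 := by omega
  have : opA n P ∘ₗ opB n P = opB n P ∘ₗ opA n P + opC n P := by
    refine E_ext fun i hi hi' => ?_
    rw [LinearMap.add_apply, LinearMap.comp_apply, LinearMap.comp_apply]
    rcases index_cases hn hi hi' with rfl | rfl | h | rfl | rfl | rfl | rfl | h
    · rw [opB_one hn, map_add, map_smul, map_smul, opA_E hn (by omega) (by omega) (by omega),
        opA_E hn (by omega) (by omega) (by omega), opA_E hn (by omega) (by omega) (by omega),
        opB_two hn, opC_one hn, e2]
      module
    · rw [opB_two hn, map_add, map_smul, map_smul, opA_E hn (by omega) (by omega) (by omega),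
        opA_last hn (by omega), opA_E hn (by omega) (by omega) (by omega),
        opB_E hn (by omega) (by omega), opC_E hn (by omega) (by omega) (by omega)]
      module
    · rw [opB_E hn (by omega) (by omega), map_smul, opA_E hn (by omega) (by omega) (by omega),
        opA_E hn (by omega) (by omega) (by omega),
        opB_E hn (by omega) (by omega), opC_E hn (by omega) (by omega) (by omega), add_zero]
    · rw [opB_E hn (by omega) (by omega), map_smul, opA_last hn (by omega),
        opA_E hn (by omega) (by omega) (by omega),
        opB_last hn (by omega), opC_E hn (by omega) (by omega) (by omega), add_zero, smul_zero]
    · rw [opB_last hn (by omega), opA_last hn (by omega),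
        opC_E hn (by omega) (by omega) (by omega)]
      simp
    · rw [opB_f1 hn, map_smul, opA_E hn (by omega) (by omega) (by omega),
        opA_E hn (by omega) (by omega) (by omega), e1, e2, opB_f2 hn, opC_f1 hn]
      module
    · rw [opB_f2 hn, map_smul, opA_last hn (by omega),
        opA_E hn (by omega) (by omega) (by omega), opB_last hn (by omega),
        opC_E hn (by omega) (by omega) (by omega)]
      simp
    · rw [opB_last hn (by omega), opA_last hn (by omega),
        opC_E hn (by omega) (by omega) (by omega)]
      simp
  exact LinearMap.congr_fun this v

/-! Coordinates of products in low degrees. -/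

theorem X_one_opA (hn : 9 ≤ n) (v : Fin n → ℂ) : X n 1 (opA n P v) = 0 := by
  have : X n 1 ∘ₗ opA n P = 0 := by
    refine E_ext fun i hi hi' => ?_
    rcases index_cases hn hi hi' with rfl | rfl | h | rfl | rfl | rfl | rfl | rfl <;>
    simp (disch := omega) [opA_E, opA_last, X_E_ne]
  exact LinearMap.congr_fun this v

theorem X_one_opB (hn : 9 ≤ n) (v : Fin n → ℂ) : X n 1 (opB n P v) = 0 := by
  have : X n 1 ∘ₗ opB n P = 0 := by
    refine E_ext fun i hi hi' => ?_
    rcases index_cases hn hi hi' with rfl | rfl | h | rfl | rfl | rfl | rfl | rfl <;>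
    simp (disch := omega) [opB_one, opB_two, opB_E, opB_f1, opB_f2, opB_last, X_E_ne]
  exact LinearMap.congr_fun this v

theorem X_f1_opA (hn : 9 ≤ n) (v : Fin n → ℂ) : X n (n - 2) (opA n P v) = 0 := by
  have : X n (n - 2) ∘ₗ opA n P = 0 := by
    refine E_ext fun i hi hi' => ?_
    rcases index_cases hn hi hi' with rfl | rfl | h | rfl | rfl | rfl | rfl | rfl <;>
    simp (disch := omega) [opA_E, opA_last, X_E_ne]
  exact LinearMap.congr_fun this v

theorem X_f1_opB (hn : 9 ≤ n) (v : Fin n → ℂ) : X n (n - 2) (opB n P v) = 0 := by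
  have : X n (n - 2) ∘ₗ opB n P = 0 := by
    refine E_ext fun i hi hi' => ?_
    rcases index_cases hn hi hi' with rfl | rfl | h | rfl | rfl | rfl | rfl | rfl <;>
    simp (disch := omega) [opB_one, opB_two, opB_E, opB_f1, opB_f2, opB_last, X_E_ne]
  exact LinearMap.congr_fun this v

theorem X_two_opA (hn : 9 ≤ n) (v : Fin n → ℂ) : X n 2 (opA n P v) = X n 1 v := by
  have : X n 2 ∘ₗ opA n P = X n 1 := by
    refine E_ext fun i hi hi' => ?_
    rcases index_cases hn hi hi' with rfl | rfl | h | rfl | rfl | rfl | rfl | rfl <;>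
    simp (disch := omega) [opA_E, opA_last, X_E_of_eq, X_E_ne]
  exact LinearMap.congr_fun this v

theorem X_two_opB (hn : 9 ≤ n) (v : Fin n → ℂ) : X n 2 (opB n P v) = P.α * X n 1 v := by
  have : X n 2 ∘ₗ opB n P = P.α • X n 1 := by
    refine E_ext fun i hi hi' => ?_
    rcases index_cases hn hi hi' with rfl | rfl | h | rfl | rfl | rfl | rfl | rfl <;>
    simp (disch := omega) [opB_one, opB_two, opB_E, opB_f1, opB_f2, opB_last, X_E_of_eq, X_E_ne]
  exact LinearMap.congr_fun this v

theorem X_f2_opA (hn : 9 ≤ n) (v : Fin n → ℂ) : X n (n - 1) (opA n P v) = X n (n - 2) v := by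
  have : X n (n - 1) ∘ₗ opA n P = X n (n - 2) := by
    refine E_ext fun i hi hi' => ?_
    rcases index_cases hn hi hi' with rfl | rfl | h | rfl | rfl | rfl | rfl | rfl <;>
    simp (disch := omega) [opA_E, opA_last, X_E_of_eq, X_E_ne]
  exact LinearMap.congr_fun this v

theorem X_f2_opB (hn : 9 ≤ n) (v : Fin n → ℂ) : X n (n - 1) (opB n P v) = P.β * X n 1 v + P.δ * X n (n - 2) v := by
  have : X n (n - 1) ∘ₗ opB n P = P.β • X n 1 + P.δ • X n (n - 2) := by
    refine E_ext fun i hi hi' => ?_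
    rcases index_cases hn hi hi' with rfl | rfl | h | rfl | rfl | rfl | rfl | rfl <;>
    simp (disch := omega) [opB_one, opB_two, opB_E, opB_f1, opB_f2, opB_last, X_E_of_eq, X_E_ne]
  exact LinearMap.congr_fun this v

theorem X_three_opA (hn : 9 ≤ n) (v : Fin n → ℂ) : X n 3 (opA n P v) = X n 2 v := by
  have : X n 3 ∘ₗ opA n P = X n 2 := by
    refine E_ext fun i hi hi' => ?_
    rcases index_cases hn hi hi' with rfl | rfl | h | rfl | rfl | rfl | rfl | rfl <;>
    simp (disch := omega) [opA_E, opA_last, X_E_of_eq, X_E_ne]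
  exact LinearMap.congr_fun this v

theorem X_three_opB (hn : 9 ≤ n) (v : Fin n → ℂ) : X n 3 (opB n P v) = P.α * X n 2 v := by
  have : X n 3 ∘ₗ opB n P = P.α • X n 2 := by
    refine E_ext fun i hi hi' => ?_
    rcases index_cases hn hi hi' with rfl | rfl | h | rfl | rfl | rfl | rfl | rfl <;>
    simp (disch := omega) [opB_one, opB_two, opB_E, opB_f1, opB_f2, opB_last, X_E_of_eq, X_E_ne]
  exact LinearMap.congr_fun this v

theorem X_f3_opA (hn : 9 ≤ n) (v : Fin n → ℂ) : X n n (opA n P v) = X n (n - 1) v := by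
  have : X n n ∘ₗ opA n P = X n (n - 1) := by
    refine E_ext fun i hi hi' => ?_
    rcases index_cases hn hi hi' with rfl | rfl | h | rfl | rfl | rfl | rfl | rfl <;>
    simp (disch := omega) [opA_E, opA_last, X_E_of_eq, X_E_ne]
  exact LinearMap.congr_fun this v

theorem X_f3_opB (hn : 9 ≤ n) (v : Fin n → ℂ) : X n n (opB n P v) = (P.β - P.ν) * X n 2 v + (P.δ - P.σ) * X n (n - 1) v := by
  have : X n n ∘ₗ opB n P = (P.β - P.ν) • X n 2 + (P.δ - P.σ) • X n (n - 1) := by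
    refine E_ext fun i hi hi' => ?_
    rcases index_cases hn hi hi' with rfl | rfl | h | rfl | rfl | rfl | rfl | rfl <;>
    simp (disch := omega) [opB_one, opB_two, opB_E, opB_f1, opB_f2, opB_last, X_E_of_eq, X_E_ne]
  exact LinearMap.congr_fun this v

theorem X_four_opA (hn : 9 ≤ n) (v : Fin n → ℂ) : X n 4 (opA n P v) = X n 3 v := by
  have : X n 4 ∘ₗ opA n P = X n 3 := by
    refine E_ext fun i hi hi' => ?_
    by_cases h3 : i = 3
    · subst h3
      simp (disch := omega) [opA_E, X_E_of_eq]
    rcases index_cases hn hi hi' with rfl | rfl | h | rfl | rfl | rfl | rfl | rfl <;>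
    simp (disch := omega) [opA_E, opA_last, X_E_ne]
  exact LinearMap.congr_fun this v

theorem X_four_opB (hn : 9 ≤ n) (v : Fin n → ℂ) : X n 4 (opB n P v) = P.α * X n 3 v := by
  have : X n 4 ∘ₗ opB n P = P.α • X n 3 := by
    refine E_ext fun i hi hi' => ?_
    by_cases h3 : i = 3
    · subst h3
      simp (disch := omega) [opB_E, X_E_of_eq]
    rcases index_cases hn hi hi' with rfl | rfl | h | rfl | rfl | rfl | rfl | rfl <;>
    simp (disch := omega) [opB_one, opB_two, opB_E, opB_f1, opB_f2, opB_last, X_E_ne]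
  exact LinearMap.congr_fun this v

theorem X_opC (hn : 9 ≤ n) {k : ℕ} (hk : 1 ≤ k) (hk' : k < n) (v : Fin n → ℂ) :
    X n k (opC n P v) = 0 := by
  rw [opC_apply hn, map_smul, X_E_ne hk hk'.le (by omega) hk'.ne', smul_zero]

theorem X_f3_opC (hn : 9 ≤ n) (v : Fin n → ℂ) :
    X n n (opC n P v) = P.ν * X n 1 v + P.σ * X n (n - 2) v := by
  rw [opC_apply hn, map_smul, X_E_self (by omega) le_rfl, smul_eq_mul, mul_one]

/-- The identity says `R_[y,z] = R_z R_y - R_y R_z`. Every `R_w` is a combination of `A`, `B`, `C`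
with `AB - BA = C` and all other products involving `C` zero, so both sides are multiples of `C`.
Their difference is a combination of `δ C` and `(β + 1) C`, which vanish by `Good`. -/
theorem isLeibniz_model (hn : 9 ≤ n) (hP : P.Good) : IsLeibniz (model n P) := by
  intro x y z
  have hC : opC n P (opC n P x) = 0 := by
    rw [opC_apply hn (v := x), map_smul, opC_E hn (by omega) (by omega) (by omega), smul_zero]
  have h1 : P.δ • opC n P x = 0 := by
    rw [opC_apply hn, smul_smul]
    rw [show P.δ * (P.ν * X n 1 x + P.σ * X n (n - 2) x) = 0 by
      linear_combination X n 1 x * hP.δν + X n (n - 2) x * hP.δσ, zero_smul]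
  have h2 : (P.β + 1) • opC n P x = 0 := by
    rw [opC_apply hn, smul_smul]
    rw [show (P.β + 1) * (P.ν * X n 1 x + P.σ * X n (n - 2) x) = 0 by
      linear_combination X n 1 x * hP.βν + X n (n - 2) x * hP.βσ, zero_smul]
  simp only [model_apply hn, map_add, map_smul, X_one_opA hn, X_one_opB hn, X_f1_opA hn,
    X_f1_opB hn, X_f2_opA hn, X_f2_opB hn, X_opC hn (k := 1) (by omega) (by omega),
    X_opC hn (k := n - 2) (by omega) (by omega), X_opC hn (k := n - 1) (by omega) (by omega),
    opC_opA hn, opC_opB hn, opA_opC hn, opB_opC hn, opA_opB hn, hC,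
    LinearMap.add_apply, LinearMap.smul_apply, smul_zero, add_zero, smul_eq_mul, mul_zero,
    zero_smul]
  linear_combination (norm := module) (X n (n - 2) y * X n (n - 2) z) • h1
    + (X n (n - 2) z * X n 1 y) • h2

end Operators

/-! ### The associated graded algebra and its degree derivation -/

section Graded

variable {L : Type*} [AddCommGroup L] [Module ℂ L] {b : L →ₗ[ℂ] L →ₗ[ℂ] L}

theorem grBracket_lof (hb : IsLeibniz b) (i j : ℕ) (x : lcs b i) (y : lcs b j) :
    grBracket b hb (DirectSum.lof ℂ ℕ (grPiece b) i (Submodule.Quotient.mk x))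
      (DirectSum.lof ℂ ℕ (grPiece b) j (Submodule.Quotient.mk y)) =
    DirectSum.lof ℂ ℕ (grPiece b) (i + j + 1)
      (Submodule.Quotient.mk ⟨b x y, bracket_mem_lcs hb j i x.2 y.2⟩) := by
  simp only [grBracket, DirectSum.toModule_lof, LinearMap.flip_apply, LinearMap.compr₂_apply]
  rfl

theorem lcs_antitone (b : L →ₗ[ℂ] L →ₗ[ℂ] L) : Antitone (lcs b) :=
  antitone_nat_of_succ_le (lcs_succ_le b)

/-- An algebra with a basis of weight vectors whose descending central series is the filtration by
weights is isomorphic to its associated graded algebra. -/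
theorem isomorphic_grBracket_of_weights {ι : Type*} (e : Module.Basis ι ℂ L) (wt : ι → ℕ)
    (hb : IsLeibniz b) (hlcs : ∀ k, lcs b k = Submodule.span ℂ (e '' {i | k ≤ wt i}))
    (hgr : ∀ i j, b (e i) (e j) ∈ Submodule.span ℂ (e '' {l | wt l = wt i + wt j + 1})) :
    Isomorphic b (grBracket b hb) := by
  have hmem : ∀ i, e i ∈ lcs b (wt i) := fun i => by
    rw [hlcs]; exact Submodule.subset_span ⟨i, by simp, rfl⟩
  let Φ : L →ₗ[ℂ] Gr b := e.constr ℂ fun i =>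
    DirectSum.lof ℂ ℕ (grPiece b) (wt i) (Submodule.Quotient.mk ⟨e i, hmem i⟩)
  have hΦ : ∀ i, Φ (e i) =
      DirectSum.lof ℂ ℕ (grPiece b) (wt i) (Submodule.Quotient.mk ⟨e i, hmem i⟩) :=
    fun i => e.constr_basis ℂ _ i
  have hΦG : ∀ k, ∀ u ∈ Submodule.span ℂ (e '' {l | wt l = k}), ∃ hu : u ∈ lcs b k,
      Φ u = DirectSum.lof ℂ ℕ (grPiece b) k (Submodule.Quotient.mk ⟨u, hu⟩) := by
    intro k u hu
    induction hu using Submodule.span_induction with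
    | mem u hu =>
      obtain ⟨i, rfl, rfl⟩ := hu
      exact ⟨hmem i, hΦ i⟩
    | zero => exact ⟨zero_mem _, by rw [map_zero]; exact (map_zero _).symm⟩
    | add u v _ _ hu hv =>
      obtain ⟨hu, hu'⟩ := hu
      obtain ⟨hv, hv'⟩ := hv
      exact ⟨add_mem hu hv, by rw [map_add, hu', hv', ← map_add]; rfl⟩
    | smul c u _ hu =>
      obtain ⟨hu, hu'⟩ := hu
      exact ⟨Submodule.smul_mem _ c hu, by rw [map_smul, hu', ← map_smul]; rfl⟩
  -- The projection to weight `k` kills `lcs b (k + 1)`, hence descends to the `k`-th graded piece;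
  -- together these give a left inverse of `Φ`.
  let π : ℕ → L →ₗ[ℂ] L := fun k => e.constr ℂ fun i => if wt i = k then e i else 0
  have hπ : ∀ k i, π k (e i) = if wt i = k then e i else 0 := fun k i => e.constr_basis ℂ _ i
  let Ψ : Gr b →ₗ[ℂ] L := DirectSum.toModule ℂ ℕ L fun k =>
    Submodule.liftQ _ (π k ∘ₗ (lcs b k).subtype) (by
      intro x hx
      rw [LinearMap.mem_ker, LinearMap.comp_apply]
      have hx' : (x : L) ∈ lcs b (k + 1) := Submodule.mem_comap.1 hx
      have : lcs b (k + 1) ≤ LinearMap.ker (π k) := by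
        rw [hlcs, Submodule.span_le]
        rintro _ ⟨i, hi, rfl⟩
        rw [SetLike.mem_coe, LinearMap.mem_ker, hπ, if_neg]
        simp only [Set.mem_ofPred_eq] at hi
        omega
      exact LinearMap.mem_ker.1 (this hx'))
  have hΨΦ : Ψ ∘ₗ Φ = LinearMap.id := by
    refine e.ext fun i => ?_
    rw [LinearMap.comp_apply, hΦ]
    simp only [Ψ, DirectSum.toModule_lof, LinearMap.id_apply]
    rw [Submodule.liftQ_apply, LinearMap.comp_apply, Submodule.subtype_apply, hπ, if_pos rfl]
  have hsurj : Function.Surjective Φ := by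
    rw [← LinearMap.range_eq_top, eq_top_iff]
    intro z _
    induction z using DirectSum.induction_on with
    | zero => exact zero_mem _
    | add x y hx hy => exact add_mem (hx trivial) (hy trivial)
    | of k x =>
      obtain ⟨⟨u, hu⟩, rfl⟩ := Submodule.Quotient.mk_surjective _ x
      have hu' := hu
      rw [hlcs] at hu'
      suffices h : ∀ u ∈ Submodule.span ℂ (e '' {i | k ≤ wt i}), ∃ hu : u ∈ lcs b k,
          DirectSum.lof ℂ ℕ (grPiece b) k (Submodule.Quotient.mk ⟨u, hu⟩) ∈ LinearMap.range Φ from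
        (h u hu').2
      intro u hu
      induction hu using Submodule.span_induction with
      | mem u hu =>
        obtain ⟨i, hi, rfl⟩ := hu
        simp only [Set.mem_ofPred_eq] at hi
        refine ⟨lcs_antitone b hi (hmem i), ?_⟩
        -- Basis vectors of weight greater than `k` vanish in the `k`-th piece, so those of weight
        -- exactly `k` suffice.
        rcases hi.eq_or_lt with rfl | hlt
        · exact ⟨e i, hΦ i⟩
        · convert zero_mem (LinearMap.range Φ)
          have : (Submodule.Quotient.mk ⟨e i, lcs_antitone b hi (hmem i)⟩ : grPiece b k) = 0 :=
            (Submodule.Quotient.mk_eq_zero _).2 (lcs_antitone b hlt (hmem i))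
          rw [this, map_zero]
      | zero =>
        refine ⟨zero_mem _, ?_⟩
        convert zero_mem (LinearMap.range Φ)
        exact map_zero _
      | add u v _ _ hu hv =>
        obtain ⟨hu, hu'⟩ := hu
        obtain ⟨hv, hv'⟩ := hv
        exact ⟨add_mem hu hv, by have := add_mem hu' hv'; rw [← map_add] at this; exact this⟩
      | smul c u _ hu =>
        obtain ⟨hu, hu'⟩ := hu
        refine ⟨Submodule.smul_mem _ c hu, ?_⟩
        have := Submodule.smul_mem _ c hu'
        rw [← map_smul] at this
        exact this
  have hinj : Function.Injective Φ := fun x y hxy => by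
    have := congrArg Ψ hxy
    rwa [← LinearMap.comp_apply, ← LinearMap.comp_apply, hΨΦ] at this
  have key : b.compr₂ Φ = (grBracket b hb).compl₁₂ Φ Φ := by
    refine e.ext fun i => e.ext fun j => ?_
    rw [LinearMap.compr₂_apply, LinearMap.compl₁₂_apply, hΦ, hΦ, grBracket_lof]
    exact (hΦG _ _ (hgr i j)).2
  exact ⟨LinearEquiv.ofBijective Φ ⟨hinj, hsurj⟩, fun x y => LinearMap.congr_fun₂ key x y⟩

theorem lcs_map_equiv {W : Type*} [AddCommGroup W] [Module ℂ W] {b' : W →ₗ[ℂ] W →ₗ[ℂ] W}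
    (φ : L ≃ₗ[ℂ] W) (hφ : ∀ x y, φ (b x y) = b' (φ x) (φ y)) (k : ℕ) :
    (lcs b k).map (φ : L →ₗ[ℂ] W) = lcs b' k := by
  induction k with
  | zero => simp [lcs]
  | succ k ih =>
    rw [lcs, lcs, ← ih]
    apply le_antisymm
    · rw [Submodule.map_le_iff_le_comap, Submodule.map₂_le]
      intro x hx y _
      rw [Submodule.mem_comap, LinearEquiv.coe_coe, hφ]
      exact Submodule.apply_mem_map₂ _ (Submodule.mem_map_of_mem hx) trivial
    · rw [Submodule.map₂_le]
      rintro _ ⟨x, hx, rfl⟩ y _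
      obtain ⟨y, rfl⟩ := φ.surjective y
      rw [LinearEquiv.coe_coe, ← hφ]
      exact Submodule.mem_map_of_mem (f := (φ : L →ₗ[ℂ] W))
        (Submodule.apply_mem_map₂ _ hx trivial)

theorem mem_lcs_equiv {W : Type*} [AddCommGroup W] [Module ℂ W] {b' : W →ₗ[ℂ] W →ₗ[ℂ] W}
    (φ : L ≃ₗ[ℂ] W) (hφ : ∀ x y, φ (b x y) = b' (φ x) (φ y)) {k : ℕ} {x : L} :
    φ x ∈ lcs b' k ↔ x ∈ lcs b k := by
  rw [← lcs_map_equiv φ hφ]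
  exact ⟨fun ⟨y, hy, h⟩ => by rwa [← φ.injective h], fun h => ⟨x, h, rfl⟩⟩

/-- The part of the associated graded algebra in degrees at least `k`. -/
def grFiltration (b : L →ₗ[ℂ] L →ₗ[ℂ] L) (k : ℕ) : Submodule ℂ (Gr b) :=
  ⨆ i : ℕ, ⨆ _ : k ≤ i, LinearMap.range (DirectSum.lof ℂ ℕ (grPiece b) i)

theorem lof_mem_grFiltration {k i : ℕ} (h : k ≤ i) (x : grPiece b i) :
    DirectSum.lof ℂ ℕ (grPiece b) i x ∈ grFiltration b k :=
  Submodule.mem_iSup_of_mem i (Submodule.mem_iSup_of_mem h ⟨x, rfl⟩)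

theorem grFiltration_zero : grFiltration b 0 = ⊤ := by
  rw [eq_top_iff]
  intro z _
  induction z using DirectSum.induction_on with
  | zero => exact zero_mem _
  | add x y hx hy => exact add_mem (hx trivial) (hy trivial)
  | of k x => exact lof_mem_grFiltration (Nat.zero_le k) x

/-- Brackets add degrees, which gives one inclusion. For the other, `L^(k+1) = [L^k, L]` shows that
each homogeneous component is obtained by bracketing the preceding one with degree one. -/
theorem lcs_grBracket (hb : IsLeibniz b) (k : ℕ) :
    lcs (L := Gr b) (grBracket b hb) k = grFiltration b k := by
  apply le_antisymm
  · induction k with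
    | zero => rw [grFiltration_zero]; exact le_top
    | succ k ih =>
      refine (Submodule.map₂_le_map₂ ih (le_of_eq grFiltration_zero.symm)).trans ?_
      simp only [grFiltration, Submodule.map₂_iSup_left, Submodule.map₂_iSup_right, iSup_le_iff]
      intro i _ j hj
      rw [Submodule.map₂_le]
      rintro _ ⟨x, rfl⟩ _ ⟨y, rfl⟩
      obtain ⟨x, rfl⟩ := Submodule.Quotient.mk_surjective _ x
      obtain ⟨y, rfl⟩ := Submodule.Quotient.mk_surjective _ y
      rw [grBracket_lof]
      exact lof_mem_grFiltration (by omega) _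
  · simp only [grFiltration, iSup_le_iff]
    intro i hi
    refine le_trans ?_ (lcs_antitone (L := Gr b) (grBracket b hb) hi)
    clear hi
    induction i with
    | zero => exact le_top
    | succ i ih =>
      rintro _ ⟨x, rfl⟩
      obtain ⟨⟨u, hu⟩, rfl⟩ := Submodule.Quotient.mk_surjective _ x
      have key : lcs b (i + 1) ≤ Submodule.map (lcs b (i + 1)).subtype
          (Submodule.comap (DirectSum.lof ℂ ℕ (grPiece b) (i + 1) ∘ₗ Submodule.mkQ _)
            (lcs (L := Gr b) (grBracket b hb) (i + 1))) := by
        refine Submodule.map₂_le.2 fun x hx y _ => ?_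
        refine ⟨⟨b x y, Submodule.apply_mem_map₂ b hx trivial⟩, ?_, rfl⟩
        have h := grBracket_lof hb i 0 ⟨x, hx⟩ ⟨y, trivial⟩
        have h2 : _ ∈ lcs (L := Gr b) (grBracket b hb) (i + 1) :=
          Submodule.apply_mem_map₂ (grBracket b hb) (ih ⟨Submodule.Quotient.mk ⟨x, hx⟩, rfl⟩)
            (Submodule.mem_top (x := DirectSum.lof ℂ ℕ (grPiece b) 0
              (Submodule.Quotient.mk ⟨y, trivial⟩)))
        rw [h] at h2
        exact h2
      obtain ⟨⟨v, hv⟩, hmem, rfl⟩ := key hu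
      exact hmem

/-- A naturally graded algebra has a derivation acting on `L^k / L^(k+1)` as multiplication
by `k`. -/
theorem IsNaturallyGraded.exists_derivation (h : IsNaturallyGraded b) :
    ∃ D : L →ₗ[ℂ] L, (∀ u v, D (b u v) = b (D u) v + b u (D v)) ∧
      ∀ k, ∀ u ∈ lcs b k, D u - ((k : ℂ) + 1) • u ∈ lcs b (k + 1) := by
  obtain ⟨hb, -, ψ, hψ⟩ := h
  -- The factor is `k + 1` because piece `k` is `L^(k+1) / L^(k+2)`.
  let D : Gr b →ₗ[ℂ] Gr b := DirectSum.toModule ℂ ℕ _ fun k =>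
    ((k : ℂ) + 1) • DirectSum.lof ℂ ℕ (grPiece b) k
  have hD : ∀ k x, D (DirectSum.lof ℂ ℕ (grPiece b) k x) =
      ((k : ℂ) + 1) • DirectSum.lof ℂ ℕ (grPiece b) k x := fun k x => by
    simp only [D, DirectSum.toModule_lof]; rfl
  have hder : ∀ u v, D (grBracket b hb u v) = grBracket b hb (D u) v + grBracket b hb u (D v) := by
    intro u v
    induction u using DirectSum.induction_on with
    | zero => simp
    | add x y hx hy => simp only [map_add, LinearMap.add_apply, hx, hy]; abel
    | of i x =>
      induction v using DirectSum.induction_on with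
      | zero => simp
      | add x y hx hy => simp only [map_add, hx, hy]; abel
      | of j y =>
        obtain ⟨x, rfl⟩ := Submodule.Quotient.mk_surjective _ x
        obtain ⟨y, rfl⟩ := Submodule.Quotient.mk_surjective _ y
        simp only [← DirectSum.lof_eq_of ℂ]
        rw [hD, hD, map_smul, map_smul, LinearMap.smul_apply, grBracket_lof, hD]
        push_cast
        module
  have hfil : ∀ k, ∀ u ∈ grFiltration b k,
      D u + (-((k : ℂ) + 1)) • u ∈ grFiltration b (k + 1) := by
    intro k
    suffices h : grFiltration b k ≤ (grFiltration b (k + 1)).comap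
        (D + (-((k : ℂ) + 1)) • LinearMap.id) from fun u hu =>
      Submodule.mem_comap.1 (h hu)
    conv_lhs => rw [grFiltration]
    simp only [iSup_le_iff]
    rintro i hi _ ⟨x, rfl⟩
    rw [Submodule.mem_comap, LinearMap.add_apply, hD, LinearMap.smul_apply, LinearMap.id_apply]
    rcases hi.eq_or_lt with rfl | hlt
    · rw [← add_smul, add_neg_cancel, zero_smul]; exact zero_mem _
    · rw [← add_smul]
      exact Submodule.smul_mem _ _ (lof_mem_grFiltration hlt x)
  refine ⟨ψ.symm.toLinearMap ∘ₗ D ∘ₗ ψ.toLinearMap, fun u v => ?_, fun k u hu => ?_⟩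
  · apply ψ.injective
    simp [hψ, hder]
  · rw [sub_eq_add_neg, ← neg_smul]
    rw [← mem_lcs_equiv (W := Gr b) ψ hψ, lcs_grBracket] at hu ⊢
    have := hfil k _ hu
    rwa [map_add, map_smul, LinearMap.comp_apply, LinearMap.comp_apply, LinearEquiv.coe_coe,
      LinearEquiv.coe_coe, LinearEquiv.apply_symm_apply]

end Graded

/-! ### The weight grading of the models -/

/-- The degree of `e_k`, shifted by one. -/
def wt (n k : ℕ) : ℕ := if k ≤ n - 3 then k - 1 else k - (n - 2)

/-- The span of the basis vectors whose weight lies in a given set. -/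
def weightSpan (n : ℕ) (s : Set ℕ) : Submodule ℂ (Fin n → ℂ) :=
  Submodule.span ℂ (Pi.basisFun ℂ (Fin n) '' {l | wt n (l + 1) ∈ s})

theorem E_mem_weightSpan {n : ℕ} {s : Set ℕ} {k : ℕ} (hk : 1 ≤ k) (hk' : k ≤ n)
    (h : wt n k ∈ s) : E n k ∈ weightSpan n s := by
  obtain ⟨k, rfl⟩ := Nat.exists_eq_add_of_le' hk
  rw [E_eq_single (by omega), ← Pi.basisFun_apply]
  exact Submodule.subset_span ⟨⟨k, by omega⟩, by simpa using h, rfl⟩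

theorem weightSpan_le {n : ℕ} {s : Set ℕ} {S : Submodule ℂ (Fin n → ℂ)}
    (h : ∀ k, 1 ≤ k → k ≤ n → wt n k ∈ s → E n k ∈ S) : weightSpan n s ≤ S := by
  refine Submodule.span_le.2 ?_
  rintro _ ⟨l, hl, rfl⟩
  have := h (l + 1) (by omega) (by omega) hl
  rwa [E_eq_single l.2, ← Pi.basisFun_apply] at this

section Operators

variable {n : ℕ} {P : Params}

theorem opA_mem_weightSpan (hn : 9 ≤ n) {s : Set ℕ} {i : ℕ} (hi : 1 ≤ i) (hi' : i ≤ n)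
    (h : wt n i + 1 ∈ s) : opA n P (E n i) ∈ weightSpan n s := by
  by_cases hl : i = n - 3 ∨ i = n
  · rw [opA_last hn hl]; exact zero_mem _
  · rw [opA_E hn hi (by omega) (by omega)]
    refine E_mem_weightSpan (by omega) (by omega) ?_
    rwa [show wt n (i + 1) = wt n i + 1 by unfold wt; split_ifs <;> omega]

theorem opB_mem_weightSpan (hn : 9 ≤ n) {s : Set ℕ} {i : ℕ} (hi : 1 ≤ i) (hi' : i ≤ n)
    (h : wt n i + 1 ∈ s) : opB n P (E n i) ∈ weightSpan n s := by
  have key : ∀ k, 1 ≤ k → k ≤ n → wt n k = wt n i + 1 → E n k ∈ weightSpan n s :=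
    fun k hk hk' hw => E_mem_weightSpan hk hk' (hw ▸ h)
  rcases index_cases hn hi hi' with rfl | rfl | h | h | rfl | rfl | rfl | h
  · rw [opB_one hn]
    refine add_mem (Submodule.smul_mem _ _ (key _ ?_ ?_ ?_))
      (Submodule.smul_mem _ _ (key _ ?_ ?_ ?_)) <;> (try unfold wt) <;> (try split_ifs) <;> omega
  · rw [opB_two hn]
    refine add_mem (Submodule.smul_mem _ _ (key _ ?_ ?_ ?_))
      (Submodule.smul_mem _ _ (key _ ?_ ?_ ?_)) <;> (try unfold wt) <;> (try split_ifs) <;> omega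
  · rw [opB_E hn (by omega) (by omega)]
    refine Submodule.smul_mem _ _ (key _ ?_ ?_ ?_) <;> (try unfold wt) <;> (try split_ifs) <;> omega
  · rw [opB_E hn (by omega) (by omega)]
    refine Submodule.smul_mem _ _ (key _ ?_ ?_ ?_) <;> (try unfold wt) <;> (try split_ifs) <;> omega
  · rw [opB_last hn (by omega)]; exact zero_mem _
  · rw [opB_f1 hn]
    refine Submodule.smul_mem _ _ (key _ ?_ ?_ ?_) <;> (try unfold wt) <;> (try split_ifs) <;> omega
  · rw [opB_f2 hn]
    refine Submodule.smul_mem _ _ (key _ ?_ ?_ ?_) <;> (try unfold wt) <;> (try split_ifs) <;> omega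
  · rw [opB_last hn (by omega)]; exact zero_mem _

theorem opC_mem_weightSpan (hn : 9 ≤ n) {s : Set ℕ} {i : ℕ} (hi : 1 ≤ i) (hi' : i ≤ n)
    (h : wt n i + 2 ∈ s) : opC n P (E n i) ∈ weightSpan n s := by
  have hw : wt n n = 2 := by unfold wt; split_ifs <;> omega
  by_cases h1 : i = 1
  · subst h1
    rw [opC_one hn]
    refine Submodule.smul_mem _ _ (E_mem_weightSpan (by omega) le_rfl ?_)
    rwa [hw, ← show wt n 1 + 2 = 2 by unfold wt; split_ifs <;> omega]
  by_cases h2 : i = n - 2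
  · subst h2
    rw [opC_f1 hn]
    refine Submodule.smul_mem _ _ (E_mem_weightSpan (by omega) le_rfl ?_)
    rwa [hw, ← show wt n (n - 2) + 2 = 2 by unfold wt; split_ifs <;> omega]
  rw [opC_E hn (by omega) hi' h2]
  exact zero_mem _

theorem model_E_mem_weightSpan (hn : 9 ≤ n) {i j : ℕ} (hi : 1 ≤ i) (hi' : i ≤ n) (hj : 1 ≤ j)
    (hj' : j ≤ n) : model n P (E n i) (E n j) ∈ weightSpan n {wt n i + wt n j + 1} := by
  by_cases h1 : j = 1
  · subst h1
    refine opA_mem_weightSpan (P := P) hn hi hi' ?_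
    rw [show wt n 1 = 0 by unfold wt; split_ifs <;> omega]; rfl
  by_cases h2 : j = n - 2
  · subst h2
    refine opB_mem_weightSpan (P := P) hn hi hi' ?_
    rw [show wt n (n - 2) = 0 by unfold wt; split_ifs <;> omega]; rfl
  by_cases h3 : j = n - 1
  · subst h3
    refine opC_mem_weightSpan (P := P) hn hi hi' ?_
    rw [show wt n (n - 1) = 1 by unfold wt; split_ifs <;> omega]; rfl
  rw [model_E_right_eq_zero hn hj hj' h1 h2 h3]
  exact zero_mem _

theorem weightSpan_univ : weightSpan n Set.univ = ⊤ := by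
  rw [weightSpan, ← (Pi.basisFun ℂ (Fin n)).span_eq, ← Set.image_univ]
  congr 2

/-- Every product raises the weight by at least one, and conversely each `e_i` of positive weight
equals `[e_{i-1}, e_1]`. -/
theorem lcs_model (hn : 9 ≤ n) (k : ℕ) : lcs (model n P) k = weightSpan n (Set.Ici k) := by
  induction k with
  | zero =>
    rw [lcs, ← weightSpan_univ]
    congr 1
    ext; simp
  | succ k ih =>
    rw [lcs, ih]
    apply le_antisymm
    · refine Submodule.map₂_le.2 fun v hv w _ => ?_
      rw [model_apply hn]
      have hA : weightSpan n (Set.Ici k) ≤ (weightSpan n (Set.Ici (k + 1))).comap (opA n P) :=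
        weightSpan_le fun i hi hi' h => opA_mem_weightSpan hn hi hi' (by simpa using h)
      have hB : weightSpan n (Set.Ici k) ≤ (weightSpan n (Set.Ici (k + 1))).comap (opB n P) :=
        weightSpan_le fun i hi hi' h => opB_mem_weightSpan hn hi hi' (by simpa using h)
      have hC : weightSpan n (Set.Ici k) ≤ (weightSpan n (Set.Ici (k + 1))).comap (opC n P) :=
        weightSpan_le fun i hi hi' h => opC_mem_weightSpan hn hi hi' (by
          simp only [Set.mem_Ici] at h ⊢; omega)
      exact add_mem (add_mem (Submodule.smul_mem _ _ (hA hv)) (Submodule.smul_mem _ _ (hB hv)))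
        (Submodule.smul_mem _ _ (hC hv))
    · refine weightSpan_le fun i hi hi' h => ?_
      simp only [Set.mem_Ici] at h
      have h1 : 2 ≤ i ∧ i ≠ n - 2 ∧ wt n (i - 1) + 1 = wt n i := by
        unfold wt at h ⊢
        split_ifs at h ⊢ <;> omega
      have h2 : E n i = model n P (E n (i - 1)) (E n 1) := by
        have := opA_E (P := P) hn (i := i - 1) (by omega) (by omega) (by omega)
        rw [show i - 1 + 1 = i by omega] at this
        exact this.symm
      rw [h2]
      refine Submodule.apply_mem_map₂ _ (E_mem_weightSpan (by omega) (by omega) ?_) trivial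
      simp only [Set.mem_Ici]; omega

theorem lcs_model_eq_bot (hn : 9 ≤ n) : lcs (model n P) (n - 3) = ⊥ := by
  rw [lcs_model hn, eq_bot_iff]
  refine weightSpan_le fun i hi hi' h => ?_
  exfalso
  simp only [Set.mem_Ici] at h
  unfold wt at h
  split_ifs at h <;> omega

theorem isNaturallyGraded_model (hn : 9 ≤ n) (hP : P.Good) : IsNaturallyGraded (model n P) := by
  refine ⟨isLeibniz_model hn hP, ⟨n - 3, lcs_model_eq_bot hn⟩, ?_⟩
  refine isomorphic_grBracket_of_weights (Pi.basisFun ℂ (Fin n)) (fun l => wt n (l + 1)) _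
    (fun k => lcs_model hn k) fun i j => ?_
  have := model_E_mem_weightSpan (P := P) hn (i := i + 1) (j := j + 1) (by omega) (by omega)
    (by omega) (by omega)
  rwa [E_eq_single i.2, E_eq_single j.2, ← Pi.basisFun_apply, ← Pi.basisFun_apply] at this

theorem isFirstTypeBasis_model (hn : 9 ≤ n) :
    IsFirstTypeBasis (model n P) (Pi.basisFun ℂ (Fin n)) := by
  refine ⟨?_, fun i hi hi' => ?_⟩
  · change E n 1 ∉ lcs (model n P) 1
    rw [lcs_model hn]
    intro h
    have : weightSpan n (Set.Ici 1) ≤ LinearMap.ker (X n 1) := by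
      refine weightSpan_le fun i hi hi' h => ?_
      rw [LinearMap.mem_ker, X_E_ne le_rfl (by omega) hi]
      rintro rfl
      simp only [Set.mem_Ici] at h
      unfold wt at h
      split_ifs at h <;> omega
    have h0 := LinearMap.mem_ker.1 (this h)
    rw [X_E_self le_rfl (by omega)] at h0
    exact one_ne_zero h0
  · change opA n P (E n i) = if i = n - 3 ∨ i = n then 0 else E n (i + 1)
    split_ifs with h
    · exact opA_last hn h
    · exact opA_E hn hi (by omega) (by omega)

end Operators

/-! ### Jordan block sizes and the characteristic sequence -/

section Jordan

variable {L : Type*} [AddCommGroup L] [Module ℂ L]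

theorem IsFirstTypeBasis.hasJordanSizes {b : L →ₗ[ℂ] L →ₗ[ℂ] L} {n : ℕ} (hn : 9 ≤ n)
    {e : Module.Basis (Fin n) ℂ L} (he : IsFirstTypeBasis b e) :
    HasJordanSizes (rightMul b (vec e 1)) [n - 3, 3] := by
  refine ⟨by simp; omega, by simp; omega, ?_⟩
  -- The chain index is `0` or `1`, so the offset `(n - 3) * p.1` puts the short chain right after
  -- the long one.
  let g : (Σ k : Fin [n - 3, 3].length, Fin ([n - 3, 3].get k)) → Fin n := fun p =>
    ⟨(n - 3) * p.1 + p.2, by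
      obtain ⟨k, i⟩ := p
      fin_cases k <;> have := i.2 <;> simp at this ⊢ <;> omega⟩
  have hg : Function.Bijective g := by
    constructor
    · rintro ⟨k, i⟩ ⟨k', i'⟩ h
      fin_cases k <;> fin_cases k' <;> have h1 := i.2 <;> have h2 := i'.2 <;>
        simp [g] at h h1 h2 ⊢ <;> omega
    · intro j
      by_cases hj : (j : ℕ) < n - 3
      · exact ⟨⟨⟨0, by simp⟩, ⟨j, by simpa using hj⟩⟩, by simp [g]⟩
      · refine ⟨⟨⟨1, by simp⟩, ⟨j - (n - 3), by simp; omega⟩⟩, ?_⟩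
        ext
        simp [g]; omega
  have hv : ∀ j : Fin n, e j = vec e (j + 1) := fun j => by
    rw [vec, dif_pos (by omega)]; rfl
  refine ⟨e.reindex (Equiv.ofBijective g hg).symm, fun k i => ?_⟩
  simp only [Module.Basis.reindex_apply, Equiv.symm_symm, Equiv.ofBijective_apply]
  rw [hv, he.2 _ (by omega) (by omega)]
  fin_cases k
  · have hi := i.2
    simp only [Fin.zero_eta, List.get_eq_getElem, Fin.coe_ofNat_eq_mod, Nat.zero_mod,
      List.getElem_cons_zero] at hi
    simp only [g, hv]
    simp
    split_ifs <;> first | rfl | (exfalso; omega)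
  · have hi := i.2
    simp at hi
    simp only [g, hv]
    simp
    split_ifs <;> first | rfl | (exfalso; omega)

theorem HasJordanSizes.sum_eq {T : L →ₗ[ℂ] L} {l : List ℕ} (h : HasJordanSizes T l) :
    l.sum = Module.finrank ℂ L := by
  obtain ⟨-, -, v, -⟩ := h
  rw [Module.finrank_eq_card_basis v]
  simp

/-- In a block of size greater than `N`, `T ^ N` would send the first basis vector to another basis
vector. -/
theorem HasJordanSizes.le_of_pow_eq_zero {T : L →ₗ[ℂ] L} {l : List ℕ} (h : HasJordanSizes T l)
    {N : ℕ} (hN : T ^ N = 0) {a : ℕ} (ha : a ∈ l) : a ≤ N := by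
  obtain ⟨-, -, v, hv⟩ := h
  obtain ⟨k, rfl⟩ := List.get_of_mem ha
  by_contra! hlt
  have key : ∀ j, ∀ hj : j < l.get k, (T ^ j) (v ⟨k, ⟨0, by omega⟩⟩) = v ⟨k, ⟨j, hj⟩⟩ := by
    intro j
    induction j with
    | zero => intro _; simp
    | succ j ih =>
      intro hj
      rw [pow_succ', Module.End.mul_apply, ih (by omega), hv, dif_pos hj]
  have := key N hlt
  rw [hN, LinearMap.zero_apply] at this
  exact v.ne_zero _ this.symm

/-- The combinatorial half of maximality: a first entry `n - 3` leaves total `3`, and a second entry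
`3` leaves nothing for positive entries. -/
theorem le_pair_of_sum {n : ℕ} {m : List ℕ} (h0 : 0 ∉ m) (hle : ∀ a ∈ m, a ≤ n - 3)
    (hsum : m.sum = n) (hn : 9 ≤ n) : m ≤ [n - 3, 3] := by
  rcases m with _ | ⟨a, t⟩
  · exact le_of_not_gt (List.not_lt_nil _)
  have ha := hle a (by simp)
  refine le_of_not_gt fun hlt => ?_
  rw [List.cons_lt_cons_iff] at hlt
  rcases hlt with hlt | ⟨rfl, hlt⟩
  · omega
  rcases t with _ | ⟨c, r⟩
  · exact List.not_lt_nil _ hlt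
  rw [List.cons_lt_cons_iff] at hlt
  simp only [List.sum_cons] at hsum
  rcases hlt with hlt | ⟨rfl, hlt⟩
  · omega
  rcases r with _ | ⟨d, r⟩
  · exact List.not_lt_nil _ hlt
  simp only [List.sum_cons, List.mem_cons, not_or] at hsum h0
  omega

theorem rightMul_pow_mem_lcs (b : L →ₗ[ℂ] L →ₗ[ℂ] L) (y x : L) (k : ℕ) :
    (rightMul b y ^ k) x ∈ lcs b k := by
  induction k with
  | zero => trivial
  | succ k ih =>
    rw [pow_succ', Module.End.mul_apply]
    exact Submodule.apply_mem_map₂ b ih trivial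

end Jordan

/-- The characteristic sequence is attained at `e_1`. It is maximal because `lcs` vanishes at index
`n - 3`, so `R_y ^ (n - 3) = 0` for every `y` and no block exceeds `n - 3`. -/
theorem isFirstType_model {n : ℕ} {P : Params} (hn : 9 ≤ n) (hP : P.Good) :
    IsFirstType n (model n P) := by
  have he := isFirstTypeBasis_model (P := P) hn
  refine ⟨isNaturallyGraded_model hn hP, ⟨⟨_, he.1, he.hasJordanSizes hn⟩, ?_⟩, _, he⟩
  intro y m _ hm
  refine le_pair_of_sum hm.2.1 (fun a ha => ?_) (by simpa using hm.sum_eq) hn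
  refine hm.le_of_pow_eq_zero ?_ ha
  refine LinearMap.ext fun x => ?_
  have := rightMul_pow_mem_lcs (model n P) y x (n - 3)
  rw [lcs_model_eq_bot hn] at this
  exact (Submodule.mem_bot ℂ).1 this

/-! ### Isomorphisms between models -/

/-- The change of structure constants produced by the generators `e_1 + b e_{n-2}`,
`d e_{n-2}`. -/
structure Params.Related (P Q : Params) (b d : ℂ) : Prop where
  d_ne : d ≠ 0
  p_ne : 1 + b * Q.α ≠ 0
  q_ne : 1 + b * Q.δ ≠ 0
  r_ne : 1 + b * (Q.δ - Q.σ) ≠ 0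
  hα : Q.α * d = P.α * (1 + b * Q.α)
  hδ : Q.δ * d = P.δ * (1 + b * Q.δ)
  hν : Q.ν + Q.σ * b = P.ν * (1 + b * (Q.δ - Q.σ))
  hσ : Q.σ * d = P.σ * (1 + b * (Q.δ - Q.σ))
  hβ : (Q.β + Q.δ * b) * d = P.α * b * (1 + Q.β + Q.δ * b) + P.β * d * (1 + b * Q.δ)

section

variable {n : ℕ} {P Q : Params}

theorem X_one_model (hn : 9 ≤ n) (v w : Fin n → ℂ) : X n 1 (model n P v w) = 0 := by
  simp [model_apply hn, X_one_opA hn, X_one_opB hn, X_opC hn (k := 1) le_rfl (by omega)]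

theorem X_f1_model (hn : 9 ≤ n) (v w : Fin n → ℂ) : X n (n - 2) (model n P v w) = 0 := by
  simp [model_apply hn, X_f1_opA hn, X_f1_opB hn, X_opC hn (k := n - 2) (by omega) (by omega)]

theorem X_two_model (hn : 9 ≤ n) (v w : Fin n → ℂ) :
    X n 2 (model n P v w) = X n 1 v * (X n 1 w + P.α * X n (n - 2) w) := by
  simp [model_apply hn, X_two_opA hn, X_two_opB hn, X_opC hn (k := 2) (by omega) (by omega)]
  ring

theorem X_f2_model (hn : 9 ≤ n) (v w : Fin n → ℂ) : X n (n - 1) (model n P v w) =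
    X n (n - 2) v * X n 1 w + (P.β * X n 1 v + P.δ * X n (n - 2) v) * X n (n - 2) w := by
  simp [model_apply hn, X_f2_opA hn, X_f2_opB hn, X_opC hn (k := n - 1) (by omega) (by omega)]
  ring

theorem X_three_model (hn : 9 ≤ n) (v w : Fin n → ℂ) :
    X n 3 (model n P v w) = X n 2 v * (X n 1 w + P.α * X n (n - 2) w) := by
  simp [model_apply hn, X_three_opA hn, X_three_opB hn, X_opC hn (k := 3) (by omega) (by omega)]
  ring

theorem X_four_model (hn : 9 ≤ n) (v w : Fin n → ℂ) :
    X n 4 (model n P v w) = X n 3 v * (X n 1 w + P.α * X n (n - 2) w) := by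
  simp [model_apply hn, X_four_opA hn, X_four_opB hn, X_opC hn (k := 4) (by omega) (by omega)]
  ring

theorem X_f3_model (hn : 9 ≤ n) (v w : Fin n → ℂ) : X n n (model n P v w) =
    X n (n - 1) v * X n 1 w
      + ((P.β - P.ν) * X n 2 v + (P.δ - P.σ) * X n (n - 1) v) * X n (n - 2) w
      + (P.ν * X n 1 v + P.σ * X n (n - 2) v) * X n (n - 1) w := by
  simp [model_apply hn, X_f3_opA hn, X_f3_opB hn, X_f3_opC hn]
  ring

theorem exists_opA_add (hn : 9 ≤ n) (v : Fin n → ℂ) :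
    ∃ s t : ℂ, ∃ w, v = s • E n 1 + t • E n (n - 2) + opA n P w := by
  have h : weightSpan n Set.univ ≤
      Submodule.span ℂ {E n 1, E n (n - 2)} ⊔ LinearMap.range (opA n P) := by
    refine weightSpan_le fun i hi hi' _ => ?_
    by_cases h1 : i = 1
    · exact Submodule.mem_sup_left (Submodule.subset_span (by simp [h1]))
    by_cases h2 : i = n - 2
    · exact Submodule.mem_sup_left (Submodule.subset_span (by simp [h2]))
    refine Submodule.mem_sup_right ⟨E n (i - 1), ?_⟩
    rw [opA_E hn (by omega) (by omega) (by omega), show i - 1 + 1 = i by omega]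
  rw [weightSpan_univ] at h
  obtain ⟨y, hy, _, ⟨w, rfl⟩, hv⟩ := Submodule.mem_sup.1 (h (Submodule.mem_top (x := v)))
  obtain ⟨s, t, rfl⟩ := Submodule.mem_span_pair.1 hy
  exact ⟨s, t, w, hv.symm⟩

/-- The images of `e_1` and `e_{n-2}` satisfy in the second algebra the defining relations of the
first. Reading these in low-weight coordinates, where only the components along `e_1` and `e_{n-2}`
enter, gives the equations; surjectivity gives the nonvanishing conditions. -/
theorem related_of_isomorphic (hn : 9 ≤ n) (h : Isomorphic (model n P) (model n Q)) :
    ∃ b d, P.Related Q b d := by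
  obtain ⟨φ, hφ⟩ := h
  have e1 : n - 2 + 1 = n - 1 := by omega
  have e2 : n - 1 + 1 = n := by omega
  set x := φ (E n 1) with hx
  set f := φ (E n (n - 2)) with hf
  have hsplit : ∀ v, ∃ s t : ℂ, ∃ w, v = s • x + t • f + model n Q w x := by
    intro v
    obtain ⟨s, t, w, hw⟩ := exists_opA_add (P := P) hn (φ.symm v)
    refine ⟨s, t, φ w, ?_⟩
    rw [← φ.apply_symm_apply v, hw, map_add, map_add, map_smul, map_smul, opA, rightMul_apply, hφ]
  have hA : ∀ v, φ (opA n P v) = model n Q (φ v) x := fun v => by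
    rw [opA, rightMul_apply, hφ]
  have hB : ∀ v, φ (opB n P v) = model n Q (φ v) f := fun v => by
    rw [opB, rightMul_apply, hφ]
  -- the defining relations of the first algebra, transported
  have hf2 : φ (E n (n - 1)) = model n Q f x := by
    rw [← hA, opA_E hn (by omega) (by omega) (by omega), e1]
  have hf3 : φ (E n n) = model n Q (model n Q f x) x := by
    rw [← hf2, ← hA, opA_E hn (by omega) (by omega) (by omega), e2]
  have hf4 : model n Q (model n Q (model n Q f x) x) x = 0 := by
    rw [← hf3, ← hA, opA_last hn (by omega), map_zero]
  have hxf : model n Q x f = P.α • model n Q x x + P.β • model n Q f x := by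
    rw [← hf2, ← hA, opA_E hn (by omega) (by omega) (by omega), ← hB, opB_one hn, map_add,
      map_smul, map_smul]
  have hff : model n Q f f = P.δ • model n Q f x := by
    rw [← hf2, ← hB, opB_f1 hn, map_smul]
  have hxf2 : model n Q x (model n Q f x) = P.ν • model n Q (model n Q f x) x := by
    rw [← hf3, ← hf2, ← hφ, ← map_smul, ← opC_one hn]; rfl
  have hff2 : model n Q f (model n Q f x) = P.σ • model n Q (model n Q f x) x := by
    rw [← hf3, ← hf2, ← hφ, ← map_smul, ← opC_f1 hn]; rfl
  obtain ⟨a, hXa⟩ : ∃ a, X n 1 x = a := ⟨_, rfl⟩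
  obtain ⟨b, hXb⟩ : ∃ b, X n (n - 2) x = b := ⟨_, rfl⟩
  obtain ⟨c, hXc⟩ : ∃ c, X n 1 f = c := ⟨_, rfl⟩
  obtain ⟨d, hXd⟩ : ∃ d, X n (n - 2) f = d := ⟨_, rfl⟩
  -- The images span modulo products, and products have no `e_1`- or `e_{n-2}`-coordinate, so the
  -- induced two-by-two matrix is invertible.
  have hdet : a * d - b * c ≠ 0 := by
    obtain ⟨s, t, w, h1⟩ := hsplit (E n 1)
    obtain ⟨s', t', w', h2⟩ := hsplit (E n (n - 2))
    have h11 := congrArg (X n 1) h1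
    have h12 := congrArg (X n (n - 2)) h1
    have h21 := congrArg (X n 1) h2
    have h22 := congrArg (X n (n - 2)) h2
    simp (disch := omega) only [map_add, map_smul, X_one_model hn, X_f1_model hn, X_E_of_eq,
      X_E_ne, smul_eq_mul, add_zero, hXa, hXb, hXc, hXd] at h11 h12 h21 h22
    intro h0
    have : (1 : ℂ) = 0 := by
      linear_combination (s' * b + t' * d) * h11 + h22 - (s' * a + t' * c) * h12
        + (s * t' - t * s') * h0
    exact one_ne_zero this
  have hrange : ∀ v, X n 1 v = 0 → X n (n - 2) v = 0 → ∃ w, v = model n Q w x := by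
    intro v h1 h2
    obtain ⟨s, t, w, h⟩ := hsplit v
    have h3 := congrArg (X n 1) h
    have h4 := congrArg (X n (n - 2)) h
    simp only [map_add, map_smul, X_one_model hn, X_f1_model hn, smul_eq_mul, add_zero, h1,
      h2, hXa, hXb, hXc, hXd] at h3 h4
    have hs : s = 0 := by
      have : s * (a * d - b * c) = 0 := by linear_combination (-d) * h3 + c * h4
      exact (mul_eq_zero.1 this).resolve_right hdet
    have ht : t = 0 := by
      have : t * (a * d - b * c) = 0 := by linear_combination b * h3 - a * h4
      exact (mul_eq_zero.1 this).resolve_right hdet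
    exact ⟨w, by rw [h, hs, ht]; simp⟩
  -- `e_2` must be of the form `[w, x]`, whose `e_2`-coordinate carries this factor. The same
  -- argument for `e_{n-1}` and `e_n` yields the next two factors.
  have hp : a + Q.α * b ≠ 0 := by
    obtain ⟨w, hw⟩ := hrange (E n 2) (X_E_ne (by omega) (by omega) (by omega) (by omega))
      (X_E_ne (by omega) (by omega) (by omega) (by omega))
    have := congrArg (X n 2) hw
    rw [X_E_self (by omega) (by omega), X_two_model hn, hXa, hXb] at this
    intro h0
    rw [h0, mul_zero] at this
    exact one_ne_zero this
  -- The `e_4`-coordinate of `[[[f, x], x], x] = 0` is `c (a + αb)³`.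
  have hc : c = 0 := by
    have := congrArg (X n 4) hf4
    rw [X_four_model hn, X_three_model hn, X_two_model hn, map_zero, hXa, hXb, hXc] at this
    simpa [hp] using this
  rw [hc, mul_zero, sub_zero] at hdet
  have ha := left_ne_zero_of_mul hdet
  have hd := right_ne_zero_of_mul hdet
  have hq : a + b * Q.δ ≠ 0 := by
    obtain ⟨w, hw⟩ := hrange (E n (n - 1)) (X_E_ne (by omega) (by omega) (by omega) (by omega))
      (X_E_ne (by omega) (by omega) (by omega) (by omega))
    have h1 := congrArg (X n 2) hw
    have h2 := congrArg (X n (n - 1)) hw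
    rw [X_E_ne (by omega) (by omega) (by omega) (by omega), X_two_model hn, hXa, hXb] at h1
    have hw1 : X n 1 w = 0 := (mul_eq_zero.1 h1.symm).resolve_right hp
    rw [X_E_self (by omega) (by omega), X_f2_model hn, hw1, hXa, hXb] at h2
    intro h0
    exact one_ne_zero (α := ℂ) (by linear_combination h2 + X n (n - 2) w * h0)
  have hr : a + b * (Q.δ - Q.σ) ≠ 0 := by
    obtain ⟨w, hw⟩ := hrange (E n n) (X_E_ne (by omega) (by omega) (by omega) (by omega))
      (X_E_ne (by omega) (by omega) (by omega) (by omega))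
    have h1 := congrArg (X n 2) hw
    have h2 := congrArg (X n (n - 1)) hw
    have h3 := congrArg (X n 3) hw
    have h4 := congrArg (X n n) hw
    rw [X_E_ne (by omega) (by omega) (by omega) (by omega), X_two_model hn, hXa, hXb] at h1
    have hw1 : X n 1 w = 0 := (mul_eq_zero.1 h1.symm).resolve_right hp
    rw [X_E_ne (by omega) (by omega) (by omega) (by omega), X_f2_model hn, hw1, hXa, hXb] at h2
    have hw2 : X n (n - 2) w = 0 := by
      have : X n (n - 2) w * (a + b * Q.δ) = 0 := by linear_combination -h2
      exact (mul_eq_zero.1 this).resolve_right hq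
    rw [X_E_ne (by omega) (by omega) (by omega) (by omega), X_three_model hn, hXa, hXb] at h3
    have hw3 : X n 2 w = 0 := (mul_eq_zero.1 h3.symm).resolve_right hp
    rw [X_E_self (by omega) (by omega), X_f3_model hn, hw1, hw2, hw3, hXa, hXb] at h4
    intro h0
    exact one_ne_zero (α := ℂ) (by linear_combination h4 + X n (n - 1) w * h0)
  have r1 := congrArg (X n 2) hxf
  have r2 := congrArg (X n (n - 1)) hxf
  have r3 := congrArg (X n (n - 1)) hff
  have r4 := congrArg (X n n) hxf2
  have r5 := congrArg (X n n) hff2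
  simp only [map_add, map_smul, smul_eq_mul, X_two_model hn, X_f2_model hn, X_f3_model hn,
    X_one_model hn, X_f1_model hn, hXa, hXb, hXc, hXd, hc] at r1 r2 r3 r4 r5
  -- The relations are homogeneous in `x` and `f`, so both may be divided by `a`.
  refine ⟨b / a, d / a, ?_⟩
  have hp' : 1 + b / a * Q.α ≠ 0 := by
    rw [show 1 + b / a * Q.α = (a + Q.α * b) / a by field_simp]
    exact div_ne_zero hp ha
  have hq' : 1 + b / a * Q.δ ≠ 0 := by
    rw [show 1 + b / a * Q.δ = (a + b * Q.δ) / a by field_simp]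
    exact div_ne_zero hq ha
  have hr' : 1 + b / a * (Q.δ - Q.σ) ≠ 0 := by
    rw [show 1 + b / a * (Q.δ - Q.σ) = (a + b * (Q.δ - Q.σ)) / a by field_simp]
    exact div_ne_zero hr ha
  have s1 : Q.α * d = P.α * (a + Q.α * b) := mul_left_cancel₀ ha (by linear_combination r1)
  have s3 : Q.δ * d = P.δ * (a + b * Q.δ) := mul_left_cancel₀ hd (by linear_combination r3)
  have s4 : Q.ν * a + Q.σ * b = P.ν * (a + b * (Q.δ - Q.σ)) :=
    mul_left_cancel₀ (mul_ne_zero hd hq) (by linear_combination r4)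
  have s5 : Q.σ * d = P.σ * (a + b * (Q.δ - Q.σ)) :=
    mul_left_cancel₀ (mul_ne_zero hd hq) (by linear_combination r5)
  refine ⟨div_ne_zero hd ha, hp', hq', hr', ?_, ?_, ?_, ?_, ?_⟩ <;> field_simp
  · linear_combination s1
  · linear_combination s3
  · linear_combination s4
  · linear_combination s5
  · linear_combination r2

end

/-- Structure constants of listed algebras are related only if they belong to the same name. -/
theorem Label.eq_of_related {p q : Label} (hp : p.Admissible) (hq : q.Admissible) {b d : ℂ}
    (h : p.params.Related q.params b d) : p = q := by
  obtain ⟨h1, h2, h3, h4, h5, h6, h7, h8, h9⟩ := h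
  -- For each pair of names a small polynomial system remains, in which nonzero factors make the
  -- vanishing of `α`, `δ` and `σ` invariant; it is contradictory or forces equal parameters.
  cases p <;> cases q <;> simp only [Label.params, Label.Admissible] at * <;> grind

/-! ### Algebras presented by two generators -/

section Presentation

variable {L : Type*} [AddCommGroup L] [Module ℂ L] {b : L →ₗ[ℂ] L →ₗ[ℂ] L}

/-- `x` and `f` generate the algebra, with `R_x` having two Jordan chains starting from them, and
satisfy the relations with structure constants `P`. -/
structure Presentation (n : ℕ) (b : L →ₗ[ℂ] L →ₗ[ℂ] L) (x f : L) (P : Params) : Prop where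
  leibniz : IsLeibniz b
  gen : ∀ S : Submodule ℂ L, x ∈ S → f ∈ S → (∀ u ∈ S, b u x ∈ S) → S = ⊤
  pow_x : (rightMul b x ^ (n - 3)) x = 0
  pow_f : (rightMul b x ^ 3) f = 0
  x_f : b x f = P.α • b x x + P.β • b f x
  f_f : b f f = P.δ • b f x
  x_f2 : b x (b f x) = P.ν • b (b f x) x
  f_f2 : b f (b f x) = P.σ • b (b f x) x
  f3 : ∀ u, b u (b (b f x) x) = 0

theorem pow_mem_of_closed {x u : L} {S : Submodule ℂ L} (hS : ∀ u ∈ S, b u x ∈ S) (hu : u ∈ S)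
    (k : ℕ) : (rightMul b x ^ k) u ∈ S := by
  induction k with
  | zero => simpa using hu
  | succ k ih =>
    rw [pow_succ', Module.End.mul_apply, rightMul_apply]
    exact hS _ ih

theorem rightMul_pow_succ (x u : L) (k : ℕ) :
    (rightMul b x ^ (k + 1)) u = b ((rightMul b x ^ k) u) x := by
  rw [pow_succ', Module.End.mul_apply, rightMul_apply]

/-- If `x` and `f` generate `L` under `R_x`, the two chains span `L`. -/
theorem chain_span {x f : L}
    (gen : ∀ S : Submodule ℂ L, x ∈ S → f ∈ S → (∀ u ∈ S, b u x ∈ S) → S = ⊤)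
    {S : Submodule ℂ L} (hx : ∀ k, (rightMul b x ^ k) x ∈ S)
    (hf : ∀ k, (rightMul b x ^ k) f ∈ S) : S = ⊤ := by
  have h := gen (Submodule.span ℂ (Set.range (fun k => (rightMul b x ^ k) x) ∪
    Set.range (fun k => (rightMul b x ^ k) f)))
    (Submodule.subset_span (Or.inl ⟨0, by simp⟩)) (Submodule.subset_span (Or.inr ⟨0, by simp⟩)) ?_
  · rw [eq_top_iff, ← h, Submodule.span_le]
    rintro _ (⟨k, rfl⟩ | ⟨k, rfl⟩)
    · exact hx k
    · exact hf k
  · intro u hu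
    induction hu using Submodule.span_induction with
    | mem u hu =>
      rcases hu with ⟨k, rfl⟩ | ⟨k, rfl⟩
      · exact Submodule.subset_span (Or.inl ⟨k + 1, rightMul_pow_succ x x k⟩)
      · exact Submodule.subset_span (Or.inr ⟨k + 1, rightMul_pow_succ x f k⟩)
    | zero => simp
    | add u v _ _ hu hv => rw [map_add, LinearMap.add_apply]; exact add_mem hu hv
    | smul c u _ hu => rw [map_smul, LinearMap.smul_apply]; exact Submodule.smul_mem _ _ hu

/-- The vectors of the two chains in the numbering `1, …, n`. -/
def chain (n : ℕ) (b : L →ₗ[ℂ] L →ₗ[ℂ] L) (x f : L) (k : ℕ) : L :=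
  if k ≤ n - 3 then (rightMul b x ^ (k - 1)) x else (rightMul b x ^ (k - (n - 2))) f

theorem bracket_self_right (hb : IsLeibniz b) (u x : L) : b u (b x x) = 0 := by
  rw [hb u x x, sub_self]

/-- Squares lie in the right annihilator, and the Leibniz identity makes the right annihilator
stable under `R_x`. -/
theorem bracket_pow_succ_eq_zero (hb : IsLeibniz b) (u x : L) (k : ℕ) :
    b u ((rightMul b x ^ (k + 1)) x) = 0 := by
  induction k generalizing u with
  | zero => simpa [rightMul_apply] using bracket_self_right hb u x
  | succ k ih => rw [rightMul_pow_succ, hb, ih, ih]; simp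

namespace Presentation

variable {n : ℕ} {x f : L} {P : Params}

theorem C_apply (h : Presentation n b x f P) (u : L) :
    b (b u x) f = b (b u f) x - b u (b f x) := by
  rw [h.leibniz u f x]; abel

/-- `R_x` and `R_[f,x]` commute because their commutator is, up to sign, right multiplication by
`[[f, x], x]`, which is zero. -/
theorem C_comm (h : Presentation n b x f P) (u : L) :
    b (b u x) (b f x) = b (b u (b f x)) x := by
  have := h.leibniz u (b f x) x
  rw [h.f3] at this
  exact (sub_eq_zero.1 this.symm).symm

theorem f4 (h : Presentation n b x f P) : b (b (b f x) x) x = 0 := by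
  simpa [pow_succ, rightMul_apply] using h.pow_f

theorem x2_f (h : Presentation n b x f P) :
    b (b x x) f = P.α • b (b x x) x + (P.β - P.ν) • b (b f x) x := by
  rw [h.C_apply, h.x_f, h.x_f2]
  simp only [map_add, map_smul, LinearMap.add_apply, LinearMap.smul_apply]
  module

theorem pow_f2 (h : Presentation n b x f P) (k : ℕ) :
    b ((rightMul b x ^ (k + 1)) x) (b f x) = 0 := by
  induction k with
  | zero =>
    rw [rightMul_pow_succ, h.C_comm, pow_zero, Module.End.one_apply, h.x_f2, map_smul,
      LinearMap.smul_apply, h.f4, smul_zero]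
  | succ k ih => rw [rightMul_pow_succ, h.C_comm, ih, map_zero, LinearMap.zero_apply]

/-- From the third vector of the long chain on, `R_f` acts as `α R_x`: the `f`-chain term in `[[x,
x], f]` dies under the next `R_x`, and `[f, x]` annihilates the chain beyond `x` from the right. -/
theorem pow_bracket_f (h : Presentation n b x f P) (k : ℕ) :
    b ((rightMul b x ^ (k + 2)) x) f = P.α • (rightMul b x ^ (k + 3)) x := by
  induction k with
  | zero =>
    rw [rightMul_pow_succ x x 1, h.C_apply, rightMul_pow_succ x x 2]
    have := h.pow_f2 0
    rw [zero_add] at this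
    rw [this, rightMul_pow_succ x x 1]
    have h2 := h.x2_f
    simp only [pow_one, rightMul_apply]
    rw [h2]
    simp only [map_add, map_smul, LinearMap.add_apply, LinearMap.smul_apply, h.f4]
    simp
  | succ k ih =>
    rw [rightMul_pow_succ x x (k + 2), h.C_apply, ih, h.pow_f2 (k + 1),
      rightMul_pow_succ x x (k + 3)]
    simp only [map_smul, LinearMap.smul_apply, sub_zero]

theorem f2_f2 (h : Presentation n b x f P) : b (b f x) (b f x) = 0 := by
  rw [h.C_comm, h.f_f2, map_smul, LinearMap.smul_apply, h.f4, smul_zero]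

theorem f3_f2 (h : Presentation n b x f P) : b (b (b f x) x) (b f x) = 0 := by
  rw [h.C_comm, h.f2_f2, map_zero, LinearMap.zero_apply]

theorem f2_f (h : Presentation n b x f P) : b (b f x) f = (P.δ - P.σ) • b (b f x) x := by
  rw [h.C_apply, h.f_f, h.f_f2, map_smul, LinearMap.smul_apply, sub_smul]

theorem f3_f (h : Presentation n b x f P) : b (b (b f x) x) f = 0 := by
  rw [h.C_apply, h.f2_f, h.f2_f2, map_smul, LinearMap.smul_apply, h.f4, smul_zero, sub_zero]

theorem pow_x_of_le (h : Presentation n b x f P) {k : ℕ} (hk : n - 3 ≤ k) :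
    (rightMul b x ^ k) x = 0 := by
  obtain ⟨j, rfl⟩ := Nat.exists_eq_add_of_le' hk
  rw [pow_add, Module.End.mul_apply, h.pow_x, map_zero]

theorem pow_f_of_le (h : Presentation n b x f P) {k : ℕ} (hk : 3 ≤ k) :
    (rightMul b x ^ k) f = 0 := by
  obtain ⟨j, rfl⟩ := Nat.exists_eq_add_of_le' hk
  rw [pow_add, Module.End.mul_apply, h.pow_f, map_zero]

/-- The two chains have `n` vectors in total and span, hence form a basis. Right multiplication by
`x`, `f`, `[f, x]` is computed on it from the relations, and the remaining basis vectors act as zero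
from the right. -/
theorem isomorphic_model (hn : 9 ≤ n) (hdim : Module.finrank ℂ L = n)
    (h : Presentation n b x f P) : Isomorphic b (model n P) := by
  have e1 : n - 2 - (n - 2) = 0 := by omega
  have e2 : n - 1 - (n - 2) = 1 := by omega
  have e3 : n - (n - 2) = 2 := by omega
  have cf1 : chain n b x f (n - 2) = f := by
    rw [chain, if_neg (by omega), e1]; simp
  have cf2 : chain n b x f (n - 1) = b f x := by
    rw [chain, if_neg (by omega), e2]; simp [rightMul_apply]
  have cf3 : chain n b x f n = b (b f x) x := by
    rw [chain, if_neg (by omega), e3]; simp [pow_succ, rightMul_apply]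
  have ce : ∀ k, k + 1 ≤ n - 3 → chain n b x f (k + 1) = (rightMul b x ^ k) x := fun k hk => by
    rw [chain, if_pos hk]; rfl
  have hspan : ⊤ ≤ Submodule.span ℂ (Set.range fun i : Fin n => chain n b x f (i + 1)) := by
    refine (chain_span h.gen (fun k => ?_) fun k => ?_).ge
    · by_cases hk : k < n - 3
      · exact Submodule.subset_span ⟨⟨k, by omega⟩, ce k (by omega)⟩
      · rw [h.pow_x_of_le (by omega)]; exact zero_mem _
    · by_cases hk : k < 3
      · refine Submodule.subset_span ⟨⟨k + (n - 3), by omega⟩, ?_⟩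
        change chain n b x f (k + (n - 3) + 1) = _
        rw [chain, if_neg (by omega), show k + (n - 3) + 1 - (n - 2) = k by omega]
      · rw [h.pow_f_of_le (by omega)]; exact zero_mem _
  let g := basisOfTopLeSpanOfCardEqFinrank _ hspan (by simp [hdim])
  have hg : ∀ i : Fin n, g i = chain n b x f (i + 1) := fun i => by simp [g]
  let φ : L ≃ₗ[ℂ] (Fin n → ℂ) := g.equiv (Pi.basisFun ℂ (Fin n)) (Equiv.refl _)
  have hφ : ∀ k, 1 ≤ k → k ≤ n → φ (chain n b x f k) = E n k := by
    intro k hk hk'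
    obtain ⟨k, rfl⟩ := Nat.exists_eq_add_of_le' hk
    rw [E_eq_single (by omega), ← Pi.basisFun_apply, ← hg ⟨k, by omega⟩]
    simp only [φ, Module.Basis.equiv_apply, Equiv.refl_apply]
  have hφf1 := hφ (n - 2) (by omega) (by omega)
  have hφf2 := hφ (n - 1) (by omega) (by omega)
  have hφf3 := hφ n (by omega) (by omega)
  rw [cf1] at hφf1
  rw [cf2] at hφf2
  rw [cf3] at hφf3
  have hφe : ∀ k, k + 1 ≤ n - 3 → φ ((rightMul b x ^ k) x) = E n (k + 1) := fun k hk => by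
    rw [← ce k hk, hφ _ (by omega) (by omega)]
  have hφ1 : φ x = E n 1 := by simpa using hφe 0 (by omega)
  have hφ2 : φ (b x x) = E n 2 := by simpa [rightMul_apply] using hφe 1 (by omega)
  have hφ3 : φ (b (b x x) x) = E n 3 := by
    simpa [rightMul_apply, pow_succ] using hφe 2 (by omega)
  have idx : ∀ i, 1 ≤ i → i ≤ n → i = 1 ∨ i = 2 ∨ (∃ k, i = k + 3 ∧ k + 4 ≤ n - 3) ∨
      i = n - 3 ∨ i = n - 2 ∨ i = n - 1 ∨ i = n := by
    intro i hi hi'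
    by_cases h3 : 3 ≤ i ∧ i ≤ n - 4
    · exact Or.inr (Or.inr (Or.inl ⟨i - 3, by omega, by omega⟩))
    · omega
  have clast : chain n b x f (n - 3) = (rightMul b x ^ (n - 4)) x := by
    have := ce (n - 4) (by omega)
    rwa [show n - 4 + 1 = n - 3 by omega] at this
  have hA : ∀ i, 1 ≤ i → i ≤ n → φ (b (chain n b x f i) x) = opA n P (E n i) := by
    intro i hi hi'
    by_cases h1 : i < n - 3
    · obtain ⟨i, rfl⟩ := Nat.exists_eq_add_of_le' hi
      rw [ce i (by omega), ← rightMul_pow_succ, hφe _ (by omega),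
        opA_E hn (by omega) (by omega) (by omega)]
    have : i = n - 3 ∨ i = n - 2 ∨ i = n - 1 ∨ i = n := by omega
    rcases this with rfl | rfl | rfl | h1
    · rw [clast, ← rightMul_pow_succ, h.pow_x_of_le (by omega), map_zero, opA_last hn (by omega)]
    · rw [cf1, hφf2, opA_E hn (by omega) (by omega) (by omega)]
      congr 1; omega
    · rw [cf2, hφf3, opA_E hn (by omega) (by omega) (by omega)]
      congr 1; omega
    · rw [h1, cf3, h.f4, map_zero, opA_last hn (by omega)]
  have hB : ∀ i, 1 ≤ i → i ≤ n → φ (b (chain n b x f i) f) = opB n P (E n i) := by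
    intro i hi hi'
    rcases idx i hi hi' with rfl | rfl | ⟨k, rfl, hk⟩ | rfl | rfl | rfl | h1
    · rw [ce 0 (by omega), pow_zero, Module.End.one_apply, h.x_f, map_add, map_smul, map_smul, hφ2,
        hφf2, opB_one hn]
    · rw [ce 1 (by omega), pow_one, rightMul_apply, h.x2_f, map_add, map_smul, map_smul, hφ3,
        hφf3, opB_two hn]
    · rw [ce (k + 2) (by omega), h.pow_bracket_f, map_smul, hφe _ (by omega),
        opB_E hn (by omega) (by omega)]
    · rw [clast, show n - 4 = n - 6 + 2 by omega, h.pow_bracket_f, h.pow_x_of_le (by omega),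
        smul_zero, map_zero, opB_last hn (by omega)]
    · rw [cf1, h.f_f, map_smul, hφf2, opB_f1 hn]
    · rw [cf2, h.f2_f, map_smul, hφf3, opB_f2 hn]
    · rw [h1, cf3, h.f3_f, map_zero, opB_last hn (by omega)]
  have hC : ∀ i, 1 ≤ i → i ≤ n → φ (b (chain n b x f i) (b f x)) = opC n P (E n i) := by
    intro i hi hi'
    by_cases h1 : 2 ≤ i ∧ i ≤ n - 3
    · obtain ⟨i, rfl⟩ := Nat.exists_eq_add_of_le' h1.1
      rw [ce (i + 1) (by omega), h.pow_f2, map_zero, opC_E hn (by omega) (by omega) (by omega)]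
    have : i = 1 ∨ i = n - 2 ∨ i = n - 1 ∨ i = n := by omega
    rcases this with rfl | rfl | rfl | h1
    · rw [ce 0 (by omega), pow_zero, Module.End.one_apply, h.x_f2, map_smul, hφf3, opC_one hn]
    · rw [cf1, h.f_f2, map_smul, hφf3, opC_f1 hn]
    · rw [cf2, h.f2_f2, map_zero, opC_E hn (by omega) (by omega) (by omega)]
    · rw [h1, cf3, h.f3_f2, map_zero, opC_E hn (by omega) (by omega) (by omega)]
  have key : b.compr₂ φ.toLinearMap =
      (model n P).compl₁₂ φ.toLinearMap φ.toLinearMap := by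
    refine g.ext fun i => g.ext fun j => ?_
    rw [hg, hg, LinearMap.compr₂_apply, LinearMap.compl₁₂_apply, LinearEquiv.coe_coe,
      hφ _ (by omega) (by omega), hφ _ (by omega) (by omega)]
    by_cases h1 : (j : ℕ) + 1 = 1
    · rw [h1, ce 0 (by omega), pow_zero, Module.End.one_apply, hA _ (by omega) (by omega)]; rfl
    by_cases h2 : (j : ℕ) + 1 = n - 2
    · rw [h2, cf1, hB _ (by omega) (by omega)]; rfl
    by_cases h3 : (j : ℕ) + 1 = n - 1
    · rw [h3, cf2, hC _ (by omega) (by omega)]; rfl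
    rw [model_E_right_eq_zero hn (by omega) (by omega) h1 h2 h3]
    by_cases h4 : (j : ℕ) + 1 = n
    · rw [h4, cf3, h.f3, map_zero]
    · rw [ce j (by omega), show (j : ℕ) = (j - 1) + 1 by omega,
        bracket_pow_succ_eq_zero h.leibniz, map_zero]
  exact ⟨φ, fun u v => LinearMap.congr_fun₂ key u v⟩

/-- Each field of `Related` is one relation for the new generators, read off as a coefficient. The
nonvanishing factors make the change triangular and invertible along the chains, which is what
generation needs. -/
theorem change_generators (hn : 9 ≤ n) (hdim : Module.finrank ℂ L = n) {Q : Params} {s d : ℂ}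
    (h : Presentation n b x f Q) (hr : P.Related Q s d) :
    Presentation n b (x + s • f) (d • f) P := by
  have hA : ∀ u, b u (x + s • f) = b u x + s • b u f := fun u => by rw [map_add, map_smul]
  have g2 : b (d • f) (x + s • f) = (d * (1 + s * Q.δ)) • b f x := by
    rw [hA, map_smul, LinearMap.smul_apply, LinearMap.smul_apply, h.f_f]; module
  have g3' : b (b f x) (x + s • f) = (1 + s * (Q.δ - Q.σ)) • b (b f x) x := by
    rw [hA, h.f2_f]; module
  have g3 : b (b (d • f) (x + s • f)) (x + s • f) =
      (d * (1 + s * Q.δ) * (1 + s * (Q.δ - Q.σ))) • b (b f x) x := by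
    rw [g2, map_smul, LinearMap.smul_apply, g3']; module
  have g4 : b (b (b (d • f) (x + s • f)) (x + s • f)) (x + s • f) = 0 := by
    rw [g3, map_smul, LinearMap.smul_apply, hA, h.f4, h.f3_f]; simp
  refine ⟨h.leibniz, fun S hx hf hS => ?_, ?_, ?_, ?_, ?_, ?_, ?_, ?_⟩
  · have hf1 : f ∈ S := by
      have := S.smul_mem d⁻¹ hf
      rwa [inv_smul_smul₀ hr.d_ne] at this
    have hf2 : b f x ∈ S := by
      have := S.smul_mem (d * (1 + s * Q.δ))⁻¹ (hS _ hf)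
      rwa [g2, inv_smul_smul₀ (mul_ne_zero hr.d_ne hr.q_ne)] at this
    have hf3 : b (b f x) x ∈ S := by
      have := S.smul_mem (1 + s * (Q.δ - Q.σ))⁻¹ (hS _ hf2)
      rwa [g3', inv_smul_smul₀ hr.r_ne] at this
    have hx1 : x ∈ S := by
      have := S.sub_mem hx (S.smul_mem s hf1)
      rwa [add_sub_cancel_right] at this
    have hx2 : b x x ∈ S := by
      have := S.smul_mem (1 + s * Q.α)⁻¹ (S.sub_mem (hS _ hx1) (S.smul_mem (s * Q.β) hf2))
      rwa [hA, h.x_f, show b x x + s • (Q.α • b x x + Q.β • b f x) - (s * Q.β) • b f x =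
        (1 + s * Q.α) • b x x by module, inv_smul_smul₀ hr.p_ne] at this
    have hx3 : b (b x x) x ∈ S := by
      have := S.smul_mem (1 + s * Q.α)⁻¹
        (S.sub_mem (hS _ hx2) (S.smul_mem (s * (Q.β - Q.ν)) hf3))
      rwa [hA, h.x2_f, show b (b x x) x + s • (Q.α • b (b x x) x + (Q.β - Q.ν) • b (b f x) x)
        - (s * (Q.β - Q.ν)) • b (b f x) x = (1 + s * Q.α) • b (b x x) x by module,
        inv_smul_smul₀ hr.p_ne] at this
    refine chain_span h.gen (fun k => ?_) fun k => ?_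
    · match k with
      | 0 => simpa using hx1
      | 1 => simpa [rightMul_apply] using hx2
      | k + 2 =>
        induction k with
        | zero => simpa [rightMul_apply, pow_succ] using hx3
        | succ k ih =>
          have := S.smul_mem (1 + s * Q.α)⁻¹ (hS _ ih)
          rwa [hA, h.pow_bracket_f, ← rightMul_pow_succ,
            show ∀ v : L, v + s • Q.α • v = (1 + s * Q.α) • v from fun v => by module,
            inv_smul_smul₀ hr.p_ne] at this
    · match k with
      | 0 => simpa using hf1
      | 1 => simpa [rightMul_apply] using hf2
      | 2 => simpa [rightMul_apply, pow_succ] using hf3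
      | k + 3 => rw [h.pow_f_of_le (by omega)]; exact zero_mem _
  -- The algebra is already identified with a model, where `lcs` vanishes at index `n - 3`; hence so
  -- does the power of any right multiplication.
  · obtain ⟨φ, hφ⟩ := h.isomorphic_model hn hdim
    have h1 := rightMul_pow_mem_lcs b (x + s • f) (x + s • f) (n - 3)
    rw [← mem_lcs_equiv φ hφ, lcs_model_eq_bot hn, Submodule.mem_bot] at h1
    exact φ.map_eq_zero_iff.1 h1
  · simpa [rightMul_apply, pow_succ] using g4
  · rw [g2, hA]
    simp only [map_add, map_smul, LinearMap.add_apply, LinearMap.smul_apply, h.x_f, h.f_f]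
    linear_combination (norm := module) hr.hα • b x x + hr.hβ • b f x
  · rw [g2]
    simp only [map_smul, LinearMap.smul_apply, h.f_f]
    linear_combination (norm := module) (d * hr.hδ) • b f x
  · rw [g3, g2]
    simp only [map_add, map_smul, LinearMap.add_apply, LinearMap.smul_apply, h.x_f2, h.f_f2]
    linear_combination (norm := module) (d * (1 + s * Q.δ) * hr.hν) • b (b f x) x
  · rw [g3, g2]
    simp only [map_smul, LinearMap.smul_apply, h.f_f2]
    linear_combination (norm := module) (d * (1 + s * Q.δ) * hr.hσ) • b (b f x) x
  · intro u
    rw [g3, map_smul, h.f3, smul_zero]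

end Presentation

end Presentation

/-! ### Normal forms of the structure constants -/

/-- Every admissible choice of structure constants can be normalized to a listed one. -/
theorem Params.Good.exists_label {Q : Params} (hQ : Q.Good) :
    ∃ p : Label, p.Admissible ∧ ∃ s d, p.params.Related Q s d := by
  obtain ⟨α, β, δ, ν, σ⟩ := Q
  obtain ⟨h1, h2, h3, h4⟩ := hQ
  simp only at h1 h2 h3 h4
  by_cases hc : ν = 0 ∧ σ = 0
  · obtain ⟨rfl, rfl⟩ := hc
    by_cases hα : α = 0
    · subst hα
      by_cases hδ : δ = 0
      · subst hδ
        exact ⟨.a34 β, trivial, 0, 1, by constructor <;> simp [Label.params]⟩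
      by_cases hβ : β = 1
      · subst hβ
        exact ⟨.a35 0 1, by simp [Label.Admissible], 0, 1 / δ, by
          constructor <;> simp [Label.params, hδ]⟩
      -- Here `β` becomes `(β + δs)/(1 + δs)`, a Möbius map fixing `1`. The choice `s = -β/δ` sends
      -- any other value to `0`, and `d` normalizes `δ` to `1`.
      · have hβ' : 1 - β ≠ 0 := sub_ne_zero.2 (Ne.symm hβ)
        exact ⟨.a35 0 0, by simp [Label.Admissible], -β / δ, (1 - β) / δ, by
          constructor <;> (try simp only [Label.params]) <;> (try field_simp) <;> grind⟩
    by_cases hδ : δ = 0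
    · subst hδ
      by_cases hβ : β = -1
      · subst hβ
        exact ⟨.a36 (-1), by simp [Label.Admissible], 0, 1 / α, by
          constructor <;> simp [Label.params, hα]⟩
      -- Keeping `α = 1` forces `αd = 1 + sα`; then `s = β/α` removes `β`, and `1 + sα = 1 + β` must
      -- not vanish.
      · have hβ' : 1 + β ≠ 0 := fun h => hβ (by linear_combination h)
        exact ⟨.a36 0, by simp [Label.Admissible], β / α, (1 + β) / α, by
          constructor <;> (try simp only [Label.params]) <;> (try field_simp) <;> grind⟩
    by_cases hαδ : α = δ
    · subst hαδ
      by_cases hβ : β = 0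
      · subst hβ
        exact ⟨.a35 1 0, by simp [Label.Admissible], 0, 1 / α, by
          constructor <;> simp [Label.params, hα]⟩
      -- Normalizing `α = δ` to `1` forces `αd = 1 + sα`. With `t` for this common value, `β`
      -- becomes `β / t²`, so a square root of `β` gives `1`.
      · obtain ⟨t, ht⟩ := IsAlgClosed.exists_pow_nat_eq β (n := 2) (by norm_num)
        have ht0 : t ≠ 0 := by rintro rfl; exact hβ (by simpa using ht.symm)
        exact ⟨.a35 1 1, by simp [Label.Admissible], (t - 1) / α, t / α, by
          constructor <;> (try simp only [Label.params]) <;> (try field_simp) <;> grind⟩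
    -- The witnesses solve `1/α + s = d` and `1/δ + s = d/2`, sending `(α, δ)` to `(1, 2)`; no
    -- freedom is left, so `β` survives as the parameter.
    · have hαδ' : δ - α ≠ 0 := sub_ne_zero.2 (Ne.symm hαδ)
      have hd : 2 * (δ - α) / (α * δ) ≠ 0 :=
        div_ne_zero (mul_ne_zero two_ne_zero hαδ') (mul_ne_zero hα hδ)
      have hp : 1 + (δ - 2 * α) / (α * δ) * α = α * (2 * (δ - α) / (α * δ)) := by
        field_simp; ring
      have hq : 1 + (δ - 2 * α) / (α * δ) * δ = δ * (2 * (δ - α) / (α * δ)) / 2 := by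
        field_simp; ring
      generalize (δ - 2 * α) / (α * δ) = s at *
      generalize 2 * (δ - α) / (α * δ) = d at *
      exact ⟨.a37 (((β + δ * s) * d - s * (1 + β + δ * s)) / (d * (1 + s * δ))), trivial, s, d, by
        have hp0 : 1 + s * α ≠ 0 := by rw [hp]; exact mul_ne_zero hα hd
        have hq0 : 1 + s * δ ≠ 0 := by rw [hq]; exact div_ne_zero (mul_ne_zero hδ hd) two_ne_zero
        constructor <;> try simp only [Label.params]
        · exact hd
        · exact hp0
        · exact hq0
        · simpa using hq0
        · linear_combination -hp
        · linear_combination -2 * hq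
        · simp
        · simp
        · linear_combination -div_mul_cancel₀ ((β + δ * s) * d - s * (1 + β + δ * s))
            (mul_ne_zero hd hq0)⟩
  · have hδ : δ = 0 := by
      by_contra h
      exact hc ⟨(mul_eq_zero.1 h1).resolve_left h, (mul_eq_zero.1 h2).resolve_left h⟩
    have hβ : β = -1 := by
      by_contra h
      have h' : β + 1 ≠ 0 := fun h0 => h (by linear_combination h0)
      exact hc ⟨(mul_eq_zero.1 h3).resolve_left h', (mul_eq_zero.1 h4).resolve_left h'⟩
    subst hδ hβ
    by_cases hσ : σ = 0
    · subst hσ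
      have hν : ν ≠ 0 := fun h => hc ⟨h, rfl⟩
      by_cases hα : α = 0
      · subst hα
        exact ⟨.a38 ν, hν, 0, 1, by constructor <;> simp [Label.params]⟩
      · exact ⟨.a40 0 ν, Or.inl ⟨rfl, hν⟩, 0, 1 / α, by
          constructor <;> simp [Label.params, hα]⟩
    by_cases hα : α = 0
    · subst hα
      by_cases hν : ν = -1
      · subst hν
        exact ⟨.a39 (-1), Or.inl rfl, 0, 1 / σ, by constructor <;> simp [Label.params, hσ]⟩
      -- `s = -ν/σ` makes `ν + σs = 0`; then `1 - sσ = 1 + ν`, and `d` normalizes `σ` to `1`.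
      · have hν' : 1 + ν ≠ 0 := fun h => hν (by linear_combination h)
        exact ⟨.a39 0, Or.inr rfl, -ν / σ, (1 + ν) / σ, by
          constructor <;> (try simp only [Label.params]) <;> (try field_simp) <;> grind⟩
    by_cases hασ : σ = -α
    · subst hασ
      by_cases hν : ν = -1
      · subst hν
        exact ⟨.a41 (-1), Or.inl rfl, 0, 1 / α, by constructor <;> simp [Label.params, hα]⟩
      · have hν' : 1 + ν ≠ 0 := fun h => hν (by linear_combination h)
        exact ⟨.a41 0, Or.inr rfl, ν / α, (1 + ν) / α, by
          constructor <;> (try simp only [Label.params]) <;> (try field_simp) <;> grind⟩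
    -- The witnesses solve `1/α + s = d` and `1/σ - s = d`, sending both `α` and `σ` to `1`; `ν`
    -- survives as the parameter.
    · have hs : α + σ ≠ 0 := fun h => hασ (by linear_combination h)
      have hd : (α + σ) / (2 * α * σ) ≠ 0 :=
        div_ne_zero hs (mul_ne_zero (mul_ne_zero two_ne_zero hα) hσ)
      have hp : 1 + (α - σ) / (2 * α * σ) * α = α * ((α + σ) / (2 * α * σ)) := by
        field_simp; ring
      have hr : 1 + (α - σ) / (2 * α * σ) * (0 - σ) = σ * ((α + σ) / (2 * α * σ)) := by
        field_simp; ring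
      generalize (α - σ) / (2 * α * σ) = s at *
      generalize (α + σ) / (2 * α * σ) = d at *
      exact ⟨.a40 1 ((ν + σ * s) / (1 + s * (0 - σ))), Or.inr rfl, s, d, by
        have hp0 : 1 + s * α ≠ 0 := by rw [hp]; exact mul_ne_zero hα hd
        have hr0 : 1 + s * (0 - σ) ≠ 0 := by rw [hr]; exact mul_ne_zero hσ hd
        constructor <;> try simp only [Label.params]
        · exact hd
        · exact hp0
        · simp
        · exact hr0
        · linear_combination -hp
        · simp
        · field_simp
        · linear_combination -hr
        · ring⟩

/-! ### Homogeneous generators from a basis of the first type -/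

section Homogeneous

variable {L : Type*} [AddCommGroup L] [Module ℂ L] {b : L →ₗ[ℂ] L →ₗ[ℂ] L} {n : ℕ}

theorem bracket_mem_derived (x y : L) : b x y ∈ lcs b 1 :=
  Submodule.apply_mem_map₂ b trivial trivial

/-- A nilpotent algebra is generated by any complement of its derived subalgebra; if that
complement is a line `ℂ x`, then already `[L, x] = [L, L]`. -/
theorem derived_le_range_of_line (hb : IsLeibniz b) (hnil : IsNilpotentAlg b) (x : L)
    (hx : ∀ v, ∃ c : ℂ, v - c • x ∈ lcs b 1) : lcs b 1 ≤ LinearMap.range (rightMul b x) := by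
  obtain ⟨N, hN⟩ := hnil
  have step : ∀ k, lcs b (k + 1) ≤ LinearMap.range (rightMul b x) ⊔ lcs b (k + 2) := by
    refine fun k => Submodule.map₂_le.2 fun u hu v _ => ?_
    obtain ⟨c, hc⟩ := hx v
    rw [show b u v = rightMul b x (c • u) + b u (v - c • x) by
      rw [rightMul_apply]; simp]
    refine add_mem (Submodule.mem_sup_left ⟨_, rfl⟩) (Submodule.mem_sup_right ?_)
    exact bracket_mem_lcs hb 1 k hu hc
  have all : ∀ k, lcs b 1 ≤ LinearMap.range (rightMul b x) ⊔ lcs b (k + 1) := by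
    intro k
    induction k with
    | zero => exact le_sup_right
    | succ k ih => exact ih.trans (sup_le le_sup_left (step k))
  refine (all N).trans (sup_le le_rfl ?_)
  rw [eq_bot_iff.2 ((lcs_succ_le b N).trans hN.le)]
  exact bot_le

section Basis

variable {e : Module.Basis (Fin n) ℂ L}

theorem vec_ext {S : Submodule ℂ L} (h : ∀ i, 1 ≤ i → i ≤ n → vec e i ∈ S) : S = ⊤ := by
  rw [eq_top_iff, ← e.span_eq, Submodule.span_le]
  rintro _ ⟨i, rfl⟩
  have := h (i + 1) (by omega) (by omega)
  rwa [vec, dif_pos (by omega)] at this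

theorem vec_ne_zero {k : ℕ} (hk : 1 ≤ k) (hk' : k ≤ n) : vec e k ≠ 0 := by
  rw [vec, dif_pos ⟨hk, hk'⟩]; exact e.ne_zero _

theorem IsFirstTypeBasis.bracket (he : IsFirstTypeBasis b e) {i : ℕ} (hi : 1 ≤ i) (hi' : i ≤ n - 1)
    (h : i ≠ n - 3) : b (vec e i) (vec e 1) = vec e (i + 1) := by
  rw [← rightMul_apply, he.2 i hi (by omega), if_neg (by omega)]

theorem IsFirstTypeBasis.bracket_last (he : IsFirstTypeBasis b e) {i : ℕ} (hi : 1 ≤ i)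
    (hi' : i ≤ n) (h : i = n - 3 ∨ i = n) : b (vec e i) (vec e 1) = 0 := by
  rw [← rightMul_apply, he.2 i hi hi', if_pos h]

theorem IsFirstTypeBasis.pow_one (he : IsFirstTypeBasis b e) {k : ℕ} (hk : k ≤ n - 4)
    (hn : 9 ≤ n) : (rightMul b (vec e 1) ^ k) (vec e 1) = vec e (k + 1) := by
  induction k with
  | zero => simp
  | succ k ih => rw [rightMul_pow_succ, ih (by omega), he.bracket (by omega) (by omega) (by omega)]

theorem IsFirstTypeBasis.pow_eq_zero (he : IsFirstTypeBasis b e) (hn : 9 ≤ n) :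
    rightMul b (vec e 1) ^ (n - 3) = 0 := by
  have key : ∀ k i, 1 ≤ i → i ≤ n → (n - 3 < i + k) → (i ≤ n - 3 ∨ n < i + k) →
      (rightMul b (vec e 1) ^ k) (vec e i) = 0 := by
    intro k
    induction k with
    | zero => intro i _ _ _ _; omega
    | succ k ih =>
      intro i hi hi' h1 h2
      rw [pow_succ, Module.End.mul_apply, rightMul_apply]
      by_cases hl : i = n - 3 ∨ i = n
      · rw [he.bracket_last hi hi' hl, map_zero]
      · rw [he.bracket hi (by omega) (by omega)]
        exact ih _ (by omega) (by omega) (by omega) (by omega)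
  have := vec_ext (e := e) (S := LinearMap.ker (rightMul b (vec e 1) ^ (n - 3)))
    fun i hi hi' => LinearMap.mem_ker.2 (key _ i hi hi' (by omega) (by omega))
  exact LinearMap.ker_eq_top.1 this

theorem IsFirstTypeBasis.exists_split (he : IsFirstTypeBasis b e) (hn : 9 ≤ n) (v : L) :
    ∃ s t : ℂ, ∃ w, v = s • vec e 1 + t • vec e (n - 2) + b w (vec e 1) := by
  have h : Submodule.span ℂ {vec e 1, vec e (n - 2)} ⊔ LinearMap.range (rightMul b (vec e 1))
      = ⊤ := by
    refine vec_ext (e := e) fun i hi hi' => ?_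
    by_cases h1 : i = 1
    · exact Submodule.mem_sup_left (Submodule.subset_span (by simp [h1]))
    by_cases h2 : i = n - 2
    · exact Submodule.mem_sup_left (Submodule.subset_span (by simp [h2]))
    refine Submodule.mem_sup_right ⟨vec e (i - 1), ?_⟩
    rw [rightMul_apply, he.bracket (by omega) (by omega) (by omega), show i - 1 + 1 = i by omega]
  obtain ⟨y, hy, _, ⟨w, rfl⟩, hv⟩ :=
    Submodule.mem_sup.1 (h.ge (Submodule.mem_top (x := v)))
  obtain ⟨s, t, rfl⟩ := Submodule.mem_span_pair.1 hy
  exact ⟨s, t, w, hv.symm⟩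

/-- For a basis of the first type, `[L, L] = [L, e_1]`. -/
theorem IsFirstTypeBasis.exists_of_mem_derived (he : IsFirstTypeBasis b e) (hn : 9 ≤ n)
    (hb : IsLeibniz b) (hnil : IsNilpotentAlg b) {y : L} (hy : y ∈ lcs b 1) :
    ∃ w, y = b w (vec e 1) := by
  obtain ⟨s, t, w, hw⟩ := he.exists_split hn y
  have hst : s • vec e 1 + t • vec e (n - 2) ∈ lcs b 1 := by
    have := sub_mem hy (bracket_mem_derived (b := b) w (vec e 1))
    rwa [hw, add_sub_cancel_right] at this
  -- If `t = 0`, then `e_1 ∉ L²` forces `s = 0`. Otherwise `e_{n-2}` lies in `ℂ e_1 + L²`, so `e_1`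
  -- spans `L` modulo `L²` and the line case applies.
  by_cases ht : t = 0
  · rw [ht, zero_smul, add_zero] at hst
    have hs : s = 0 := by
      by_contra hs
      refine he.1 ?_
      have := Submodule.smul_mem _ s⁻¹ hst
      rwa [inv_smul_smul₀ hs] at this
    exact ⟨w, by rw [hw, hs, ht]; simp⟩
  · obtain ⟨w', hw'⟩ := derived_le_range_of_line hb hnil (vec e 1) (fun v => by
      obtain ⟨s', t', w', hv⟩ := he.exists_split hn v
      refine ⟨s' - t' * t⁻¹ * s, ?_⟩
      have h1 := add_mem (Submodule.smul_mem _ (t' * t⁻¹) hst)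
        (bracket_mem_derived (b := b) w' (vec e 1))
      convert h1 using 1
      rw [hv, smul_add, smul_smul, smul_smul, mul_assoc t', mul_assoc t', inv_mul_cancel₀ ht]
      module) hy
    exact ⟨w', hw'.symm⟩

end Basis

/-- A derivation acting on `L^k / L^(k+1)` as multiplication by `k`. -/
structure IsGradingDerivation (b : L →ₗ[ℂ] L →ₗ[ℂ] L) (D : L →ₗ[ℂ] L) : Prop where
  der : ∀ u v, D (b u v) = b (D u) v + b u (D v)
  filt : ∀ k, ∀ u ∈ lcs b k, D u - ((k : ℂ) + 1) • u ∈ lcs b (k + 1)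

namespace IsGradingDerivation

variable {D : L →ₗ[ℂ] L}

/-- Adding an inner derivation. -/
theorem add_rightMul (hD : IsGradingDerivation b D) (hb : IsLeibniz b) (w : L) :
    IsGradingDerivation b (D + rightMul b w) := by
  constructor
  · intro u v
    simp only [LinearMap.add_apply, rightMul_apply, map_add, hD.der, hb u v w]
    abel
  · intro k u hu
    rw [LinearMap.add_apply, rightMul_apply, add_sub_right_comm]
    exact add_mem (hD.filt k u hu) (Submodule.apply_mem_map₂ b hu trivial)

theorem annihilator_stable (hD : IsGradingDerivation b D) {r : L} (hr : ∀ u, b u r = 0) (u : L) :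
    b u (D r) = 0 := by
  have := hD.der u r
  rw [hr, hr, map_zero, zero_add] at this
  exact this.symm

/-- If the defect `D v - v` lies in `lcs b (m + 1)`, then `D - 1` acts on it as `m + 1` modulo the
next term, so subtracting `(m + 1)⁻¹` times the defect pushes it one step deeper. The last clause
holds because the right annihilator is `D`-stable, so corrections starting there stay there. -/
theorem exists_weight_one (hD : IsGradingDerivation b D) (hnil : IsNilpotentAlg b) (u : L) :
    ∃ v, v - u ∈ lcs b 1 ∧ D v = v ∧
      ((∀ y, b y (D u - u) = 0) → ∀ y, b y (v - u) = 0) := by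
  obtain ⟨N, hN⟩ := hnil
  have key : ∀ m, ∃ v, v - u ∈ lcs b 1 ∧ D v - v ∈ lcs b (m + 1) ∧
      ((∀ y, b y (D u - u) = 0) → ∀ y, b y (v - u) = 0 ∧ b y (D v - v) = 0) := by
    intro m
    induction m with
    | zero =>
      refine ⟨u, by simp, ?_, fun h y => ⟨by simp, h y⟩⟩
      have := hD.filt 0 u trivial
      simpa using this
    | succ m ih =>
      obtain ⟨v, h1, h2, h3⟩ := ih
      have hm : (m : ℂ) + 1 ≠ 0 := by exact_mod_cast Nat.succ_ne_zero m
      refine ⟨v - ((m : ℂ) + 1)⁻¹ • (D v - v), ?_, ?_, fun h y => ⟨?_, ?_⟩⟩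
      · rw [sub_right_comm]
        exact sub_mem h1 (Submodule.smul_mem _ _ (lcs_antitone b (by omega) h2))
      · have := Submodule.smul_mem _ (-((m : ℂ) + 1)⁻¹) (hD.filt (m + 1) _ h2)
        convert this using 1
        push_cast
        simp only [map_sub, map_smul]
        linear_combination (norm := module) (mul_inv_cancel₀ hm) • (v - D v)
      · rw [sub_right_comm, map_sub, (h3 h y).1, map_smul, (h3 h y).2]; simp
      · have h4 := hD.annihilator_stable (fun y => (h3 h y).2) y
        have h5 := (h3 h y).2
        have e1 : D (v - ((m : ℂ) + 1)⁻¹ • (D v - v)) - (v - ((m : ℂ) + 1)⁻¹ • (D v - v)) =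
            (D v - v) - ((m : ℂ) + 1)⁻¹ • D (D v - v) + ((m : ℂ) + 1)⁻¹ • (D v - v) := by
          simp only [map_sub, map_smul]; abel
        rw [e1, map_add, map_sub, map_smul, map_smul, h4, h5]; simp
  obtain ⟨v, h1, h2, h3⟩ := key N
  rw [eq_bot_iff.2 ((lcs_succ_le b N).trans hN.le), Submodule.mem_bot, sub_eq_zero] at h2
  exact ⟨v, h1, h2, fun h y => (h3 h y).1⟩

/-- On every later quotient of the series `D` acts by a scalar different from `m + 1`, so an
eigenvector for `m + 1` keeps descending until it is zero. -/
theorem eq_zero_of_mem_lcs (hD : IsGradingDerivation b D) (hnil : IsNilpotentAlg b) {m k : ℕ}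
    (hmk : m < k) {u : L} (hu : u ∈ lcs b k) (hDu : D u = ((m : ℂ) + 1) • u) : u = 0 := by
  obtain ⟨N, hN⟩ := hnil
  have key : ∀ j, u ∈ lcs b (k + j) := by
    intro j
    induction j with
    | zero => exact hu
    | succ j ih =>
      have h1 := hD.filt _ u ih
      have hne : (m : ℂ) - ((k + j : ℕ) : ℂ) ≠ 0 := by
        rw [sub_ne_zero]; exact_mod_cast (by omega : m ≠ k + j)
      rw [hDu, ← sub_smul, show (m : ℂ) + 1 - (((k + j : ℕ) : ℂ) + 1) = m - ((k + j : ℕ) : ℂ) by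
        ring] at h1
      have := Submodule.smul_mem _ ((m : ℂ) - ((k + j : ℕ) : ℂ))⁻¹ h1
      rwa [inv_smul_smul₀ hne] at this
  have := lcs_antitone b (Nat.le_add_left N k) (key N)
  rwa [hN, Submodule.mem_bot] at this

end IsGradingDerivation

/-- Generators of weight one for a grading derivation, with `R_x` having Jordan chains of lengths
`n - 3` and `3` starting from them. -/
structure HomogeneousGenerators (n : ℕ) (b : L →ₗ[ℂ] L →ₗ[ℂ] L) (D : L →ₗ[ℂ] L) (x f : L) :
    Prop where
  leibniz : IsLeibniz b
  der : ∀ u v, D (b u v) = b (D u) v + b u (D v)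
  D_x : D x = x
  D_f : D f = f
  gen : ∀ S : Submodule ℂ L, x ∈ S → f ∈ S → (∀ u ∈ S, b u x ∈ S) → S = ⊤
  pow_x : (rightMul b x ^ (n - 3)) x = 0
  pow_x_ne : (rightMul b x ^ (n - 4)) x ≠ 0
  pow_f : (rightMul b x ^ 3) f = 0

/-- Write `D₀ e_1 - e_1 = [w, e_1]` and add `R_w` to `D₀`. The defect of `e_1` becomes `[w, e_1] +
[e_1, w]`, which lies in the right annihilator, so the correction to a fixed vector `x` leaves `R_x
= R_{e_1}`. -/
theorem IsFirstTypeBasis.exists_homogeneousGenerators (hn : 9 ≤ n)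
    {e : Module.Basis (Fin n) ℂ L} (he : IsFirstTypeBasis b e) (hb : IsNaturallyGraded b) :
    ∃ D x f, HomogeneousGenerators n b D x f ∧ ∀ u, b u x = b u (vec e 1) := by
  obtain ⟨D₀, hder, hfilt⟩ := hb.exists_derivation
  obtain ⟨hL, hnil, -⟩ := hb
  have hD₀ : IsGradingDerivation b D₀ := ⟨hder, hfilt⟩
  have h0 := hfilt 0 (vec e 1) trivial
  simp only [Nat.cast_zero, zero_add, one_smul] at h0
  obtain ⟨w, hw⟩ := he.exists_of_mem_derived hn hL hnil h0
  have hD := hD₀.add_rightMul hL w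
  set D := D₀ + rightMul b w with hDdef
  have hDe : ∀ y, b y (D (vec e 1) - vec e 1) = 0 := by
    intro y
    rw [hDdef, LinearMap.add_apply, rightMul_apply, add_sub_right_comm, hw, map_add, hL, hL]
    abel
  obtain ⟨x, hx1, hx2, hx3⟩ := hD.exists_weight_one hnil (vec e 1)
  obtain ⟨f, hf1, hf2, -⟩ := hD.exists_weight_one hnil (vec e (n - 2))
  have hxe : ∀ u, b u x = b u (vec e 1) := fun u => by
    have := hx3 hDe u
    rwa [map_sub, sub_eq_zero] at this
  have hR : rightMul b x = rightMul b (vec e 1) := LinearMap.ext hxe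
  obtain ⟨wx, hwx⟩ := he.exists_of_mem_derived hn hL hnil hx1
  obtain ⟨wf, hwf⟩ := he.exists_of_mem_derived hn hL hnil hf1
  have hx : x = vec e 1 + rightMul b x wx := by
    rw [rightMul_apply, hxe, ← hwx]; abel
  have hf : f = vec e (n - 2) + rightMul b x wf := by
    rw [rightMul_apply, hxe, ← hwf]; abel
  have hpow : rightMul b x ^ (n - 3) = 0 := by rw [hR]; exact he.pow_eq_zero hn
  have hsplit : ∀ v, ∃ s t : ℂ, ∃ u, v = s • x + t • f + rightMul b x u := by
    intro v
    obtain ⟨s, t, u, hv⟩ := he.exists_split hn v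
    refine ⟨s, t, u - s • wx - t • wf, ?_⟩
    have h1 : vec e 1 = x - rightMul b x wx := eq_sub_of_add_eq hx.symm
    have h2 : vec e (n - 2) = f - rightMul b x wf := eq_sub_of_add_eq hf.symm
    rw [← hxe, ← rightMul_apply] at hv
    rw [hv, h1, h2]
    simp only [map_sub, map_smul]
    module
  have hpx : (rightMul b x ^ (n - 4)) x ≠ 0 := by
    have h1 : (rightMul b x ^ (n - 4)) x = vec e (n - 3) := by
      nth_rewrite 2 [hx]
      rw [map_add, ← Module.End.mul_apply, ← pow_succ, show n - 4 + 1 = n - 3 by omega, hpow,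
        LinearMap.zero_apply, add_zero, hR, he.pow_one le_rfl hn]
      congr 1; omega
    rw [h1]
    exact vec_ne_zero (by omega) (by omega)
  have hDA : ∀ u, D (rightMul b x u) = rightMul b x (D u) + rightMul b x u := fun u => by
    simp only [rightMul_apply]
    rw [hD.der, hx2]
  have hDpow : ∀ (k : ℕ) (u : L), D u = u →
      D ((rightMul b x ^ k) u) = ((k : ℂ) + 1) • (rightMul b x ^ k) u := by
    intro k u hu
    induction k with
    | zero => simpa using hu
    | succ k ih =>
      rw [pow_succ', Module.End.mul_apply, hDA, ih]
      push_cast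
      rw [map_smul]; module
  have hf0 : (rightMul b x ^ 3) (vec e (n - 2)) = 0 := by
    rw [hR]
    simp only [pow_succ, pow_zero, one_mul, Module.End.mul_apply, rightMul_apply]
    rw [he.bracket (by omega) (by omega) (by omega), he.bracket (by omega) (by omega) (by omega),
      he.bracket_last (by omega) (by omega) (by omega)]
  have hf3 : (rightMul b x ^ 3) f = 0 := by
    -- `R_x³ f` has weight four but equals `R_x⁴ wf`, which lies in `L⁵`.
    refine hD.eq_zero_of_mem_lcs hnil (m := 3) (k := 4) (by norm_num) ?_ (hDpow 3 f hf2)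
    rw [hf, map_add, hf0, zero_add, ← Module.End.mul_apply, ← pow_succ]
    exact rightMul_pow_mem_lcs b x wf 4
  refine ⟨D, x, f, ?_, hxe⟩
  refine ⟨hL, hD.der, hx2, hf2, fun S hxS hfS hS => ?_, ?_, hpx, hf3⟩
  -- Iterating `hsplit` covers `L` by `S` and the range of `R_x ^ k`; the latter is zero for `k = n
  -- - 3`.
  · have key : ∀ k, ∀ v, ∃ u, v - (rightMul b x ^ k) u ∈ S := by
      intro k
      induction k with
      | zero => exact fun v => ⟨v, by simp⟩
      | succ k ih =>
        intro v
        obtain ⟨u, hu⟩ := ih v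
        obtain ⟨s, t, u', hu'⟩ := hsplit u
        refine ⟨u', ?_⟩
        have h1 : (rightMul b x ^ k) (s • x + t • f) ∈ S :=
          pow_mem_of_closed hS (S.add_mem (S.smul_mem s hxS) (S.smul_mem t hfS)) k
        have := S.add_mem hu h1
        rw [hu', map_add (rightMul b x ^ k) (s • x + t • f)] at this
        rw [pow_succ, Module.End.mul_apply]
        convert this using 1
        abel
    rw [eq_top_iff]
    intro v _
    obtain ⟨u, hu⟩ := key (n - 3) v
    rwa [hpow, LinearMap.zero_apply, sub_zero] at hu
  · rw [hpow, LinearMap.zero_apply]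

end Homogeneous

/-! ### Determination of the structure constants -/

section Structure

variable {L : Type*} [AddCommGroup L] [Module ℂ L] {b : L →ₗ[ℂ] L →ₗ[ℂ] L} {n : ℕ}

namespace HomogeneousGenerators

variable {D : L →ₗ[ℂ] L} {x f : L}

theorem D_pow (h : HomogeneousGenerators n b D x f) {u : L} (hu : D u = u) (k : ℕ) :
    D ((rightMul b x ^ k) u) = ((k : ℂ) + 1) • (rightMul b x ^ k) u := by
  induction k with
  | zero => simpa using hu
  | succ k ih =>
    rw [rightMul_pow_succ, h.der, ih, h.D_x]
    push_cast
    rw [map_smul, LinearMap.smul_apply]; module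

/-- Weight vectors are combinations of the members of the two chains of that weight. -/
theorem exists_of_weight (h : HomogeneousGenerators n b D x f) {m : ℕ} {u : L}
    (hu : D u = ((m : ℂ) + 1) • u) :
    ∃ s t : ℂ, u = s • (rightMul b x ^ m) x + t • (rightMul b x ^ m) f := by
  have hmem : ∀ {v : L}, D v = v → ∀ k : ℕ,
      (rightMul b x ^ k) v ∈ Module.End.eigenspace D ((k : ℂ) + 1) := fun hv k =>
    Module.End.mem_eigenspace_iff.2 (h.D_pow hv k)
  have hne : ∀ k : ℕ, k ≠ m → (k : ℂ) + 1 ≠ (m : ℂ) + 1 := fun k hk => by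
    simpa using hk
  -- The chain vectors are `D`-eigenvectors, so all but those at index `m` fall into other
  -- eigenspaces; independence of eigenspaces then isolates the required component.
  have htop : Submodule.span ℂ {(rightMul b x ^ m) x, (rightMul b x ^ m) f} ⊔
      (⨆ μ : ℂ, ⨆ _ : μ ≠ (m : ℂ) + 1, Module.End.eigenspace D μ) = ⊤ := by
    refine chain_span h.gen (fun k => ?_) fun k => ?_
    · by_cases hk : k = m
      · exact Submodule.mem_sup_left (Submodule.subset_span (by simp [hk]))
      · exact Submodule.mem_sup_right (Submodule.mem_iSup_of_mem _
          (Submodule.mem_iSup_of_mem (hne k hk) (hmem h.D_x k)))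
    · by_cases hk : k = m
      · exact Submodule.mem_sup_left (Submodule.subset_span (by simp [hk]))
      · exact Submodule.mem_sup_right (Submodule.mem_iSup_of_mem _
          (Submodule.mem_iSup_of_mem (hne k hk) (hmem h.D_f k)))
  obtain ⟨y, hy, v, hv, rfl⟩ := Submodule.mem_sup.1 (htop.ge (Submodule.mem_top (x := u)))
  have hspan : Submodule.span ℂ {(rightMul b x ^ m) x, (rightMul b x ^ m) f} ≤
      Module.End.eigenspace D ((m : ℂ) + 1) := by
    rw [Submodule.span_le]
    rintro _ (rfl | rfl)
    · exact hmem h.D_x m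
    · exact hmem h.D_f m
  have hv' : v ∈ Module.End.eigenspace D ((m : ℂ) + 1) := by
    have := sub_mem (Module.End.mem_eigenspace_iff.2 hu) (hspan hy)
    rwa [add_sub_cancel_left] at this
  have hv0 : v = 0 := (Submodule.disjoint_def.1
    (Module.End.eigenspaces_iSupIndep D ((m : ℂ) + 1))) v hv' hv
  obtain ⟨s, t, rfl⟩ := Submodule.mem_span_pair.1 hy
  exact ⟨s, t, by rw [hv0, add_zero]⟩

theorem pow_x_ne_zero (h : HomogeneousGenerators n b D x f) {k : ℕ} (hk : k ≤ n - 4) :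
    (rightMul b x ^ k) x ≠ 0 := by
  intro h0
  obtain ⟨j, hj⟩ := Nat.exists_eq_add_of_le' hk
  apply h.pow_x_ne
  rw [hj, pow_add, Module.End.mul_apply, h0, map_zero]

/-- Otherwise the chains would contribute at most `(n - 3) + 2 = n - 1` nonzero vectors, too few to
span. -/
theorem f3_ne_zero (h : HomogeneousGenerators n b D x f) (hn : 9 ≤ n)
    (hdim : Module.finrank ℂ L = n) : b (b f x) x ≠ 0 := by
  intro h0
  have hf2 : ∀ k, 2 ≤ k → (rightMul b x ^ k) f = 0 := by
    intro k hk
    obtain ⟨j, rfl⟩ := Nat.exists_eq_add_of_le' hk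
    rw [pow_add, Module.End.mul_apply, show (rightMul b x ^ 2) f = b (b f x) x by
      simp [pow_succ, rightMul_apply], h0, map_zero]
  have hx : ∀ k, n - 3 ≤ k → (rightMul b x ^ k) x = 0 := by
    intro k hk
    obtain ⟨j, rfl⟩ := Nat.exists_eq_add_of_le' hk
    rw [pow_add, Module.End.mul_apply, h.pow_x, map_zero]
  let v : Fin (n - 1) → L := fun i => if (i : ℕ) < n - 3 then (rightMul b x ^ (i : ℕ)) x
    else (rightMul b x ^ (i - (n - 3) : ℕ)) f
  have htop : Submodule.span ℂ (Set.range v) = ⊤ := by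
    refine chain_span h.gen (fun k => ?_) fun k => ?_
    · by_cases hk : k < n - 3
      · exact Submodule.subset_span ⟨⟨k, by omega⟩, by simp [v, hk]⟩
      · rw [hx k (by omega)]; exact zero_mem _
    · by_cases hk : k < 2
      · exact Submodule.subset_span ⟨⟨k + (n - 3), by omega⟩, by simp [v]⟩
      · rw [hf2 k (by omega)]; exact zero_mem _
  have h1 := finrank_range_le_card (R := ℂ) v
  rw [Set.finrank, htop, finrank_top, hdim, Fintype.card_fin] at h1
  omega

/-- Weights leave the unknowns `a, β, g, δ, μ, ν, ρ, σ, p, q`. The Leibniz identity propagates the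
brackets with `f`, `F1 = [f, x]`, `F2 = [F1, x]` along both chains. The end of the `f`-chain and the
commutators of these right multiplications then force `g = μ = ρ = p = q = 0`. -/
theorem exists_presentation (h : HomogeneousGenerators n b D x f) (hn : 9 ≤ n)
    (hdim : Module.finrank ℂ L = n) : ∃ P : Params, P.Good ∧ Presentation n b x f P := by
  have hb := h.leibniz
  obtain ⟨X, hX⟩ : ∃ X : ℕ → L, ∀ k, (rightMul b x ^ k) x = X k := ⟨_, fun _ => rfl⟩
  have hX0 : X 0 = x := by rw [← hX]; simp
  have hXs : ∀ k, b (X k) x = X (k + 1) := fun k => by rw [← hX, ← hX, rightMul_pow_succ]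
  have hRX : ∀ u k, b u (X (k + 1)) = 0 := fun u k => by
    rw [← hX]; exact bracket_pow_succ_eq_zero hb u x k
  -- All comparisons happen in `X 3`, `X 4` or `X 5`, and `5 ≤ n - 4` is exactly `9 ≤ n`.
  have hXne : ∀ {k : ℕ} {c : ℂ}, k ≤ 5 → c • X k = 0 → c = 0 := by
    intro k c hk hc
    refine (smul_eq_zero.1 hc).resolve_right ?_
    rw [← hX]; exact h.pow_x_ne_zero (by omega)
  have hF2ne := h.f3_ne_zero hn hdim
  have hpf1 : (rightMul b x ^ 1) f = b f x := by simp [rightMul_apply]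
  have hpf2 : (rightMul b x ^ 2) f = b (b f x) x := by simp [pow_succ, rightMul_apply]
  have hF3 : b (b (b f x) x) x = 0 := by simpa [pow_succ, rightMul_apply] using h.pow_f
  have hDF1 : D (b f x) = (2 : ℂ) • b f x := by
    have := h.D_pow h.D_f 1
    rw [hpf1] at this
    rw [this]; norm_num
  have hDF2 : D (b (b f x) x) = (3 : ℂ) • b (b f x) x := by
    have := h.D_pow h.D_f 2
    rw [hpf2] at this
    rw [this]; norm_num
  have sB : ∀ u, b (b u x) f = b (b u f) x - b u (b f x) := fun u => by rw [hb u f x]; abel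
  -- brackets of the generators, by weight
  have w2 : ∀ u, D u = (2 : ℂ) • u → ∃ s t : ℂ, u = s • X 1 + t • b f x := by
    intro u hu
    have := h.exists_of_weight (m := 1) (u := u) (by rw [hu]; norm_num)
    rwa [hX, hpf1] at this
  have w3 : ∀ u, D u = (3 : ℂ) • u → ∃ s t : ℂ, u = s • X 2 + t • b (b f x) x := by
    intro u hu
    have := h.exists_of_weight (m := 2) (u := u) (by rw [hu]; norm_num)
    rwa [hX, hpf2] at this
  have w4 : ∀ u, D u = (4 : ℂ) • u → ∃ s : ℂ, u = s • X 3 := by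
    intro u hu
    obtain ⟨s, t, hst⟩ := h.exists_of_weight (m := 3) (u := u) (by rw [hu]; norm_num)
    rw [hX, h.pow_f, smul_zero, add_zero] at hst
    exact ⟨s, hst⟩
  obtain ⟨a, β, hBx⟩ := w2 (b x f) (by rw [h.der, h.D_x, h.D_f]; module)
  obtain ⟨g, δ, hBf⟩ := w2 (b f f) (by rw [h.der, h.D_f]; module)
  obtain ⟨μ, ν, hCx⟩ := w3 (b x (b f x)) (by rw [h.der, h.D_x, hDF1, map_smul]; module)
  obtain ⟨ρ, σ, hCf⟩ := w3 (b f (b f x)) (by rw [h.der, h.D_f, hDF1, map_smul]; module)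
  obtain ⟨p, hGx⟩ := w4 (b x (b (b f x) x)) (by rw [h.der, h.D_x, hDF2, map_smul]; module)
  obtain ⟨q, hGf⟩ := w4 (b f (b (b f x) x)) (by rw [h.der, h.D_f, hDF2, map_smul]; module)
  obtain ⟨F1, hF1⟩ : ∃ F1, b f x = F1 := ⟨_, rfl⟩
  simp only [hF1] at hF2ne hF3 sB hBx hBf hCx hCf hGx hGf
  obtain ⟨F2, hF2⟩ : ∃ F2, b F1 x = F2 := ⟨_, rfl⟩
  simp only [hF2] at hF2ne hF3 hCx hCf hGx hGf
  have sC : ∀ u, b (b u x) F1 = b (b u F1) x - b u F2 := fun u => by rw [← hF2, hb u F1 x]; abel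
  have sG : ∀ u, b (b u x) F2 = b (b u F2) x := fun u => by
    have := hb u F2 x
    rw [hF3, map_zero] at this
    exact (sub_eq_zero.1 this.symm).symm
  -- `T1` to `T5` are the Leibniz identities for `[u, [f, f]]`, `[u, [x, f]]`, `[u, [x, F1]]`, `[u,
  -- [f, F1]]`, `[u, [f, F2]]`; the terms with `X (k + 1)` on the right vanish.
  have T1 : ∀ u, δ • b u F1 = 0 := fun u => by
    have := bracket_self_right hb u f
    rw [hBf, map_add, map_smul, map_smul, hRX u 0] at this
    simpa using this
  have T2 : ∀ u, (β + 1) • b u F1 = 0 := fun u => by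
    have := hb u x f
    rw [hBx, sB, map_add, map_smul, map_smul, hRX u 0] at this
    linear_combination (norm := module) this
  have T3 : ∀ u, (ν + 1) • b u F2 = 0 := fun u => by
    have := hb u x F1
    rw [hCx, sC, map_add, map_smul, map_smul, hRX u 1] at this
    linear_combination (norm := module) this
  have T4 : ∀ u, b (b u f) F1 - b (b u F1) f = σ • b u F2 := fun u => by
    have := hb u f F1
    rw [hCf, map_add, map_smul, map_smul, hRX u 1] at this
    linear_combination (norm := module) (-1 : ℂ) • this
  have T5 : ∀ u, b (b u f) F2 - b (b u F2) f = 0 := fun u => by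
    have := hb u f F2
    rw [hGf, map_smul, hRX u 2, smul_zero] at this
    exact this.symm
  have hX1 : X 1 = b x x := by rw [← hXs 0, hX0]
  -- right multiplication by `F2`
  have G0 : b (X 0) F2 = p • X 3 := by rw [hX0, hGx]
  have Gs : ∀ k, b (X k) F2 = p • X (k + 3) := by
    intro k
    induction k with
    | zero => exact G0
    | succ k ih =>
      rw [← hXs k, sG, ih, map_smul, LinearMap.smul_apply, hXs]
  have GF1 : b F1 F2 = q • X 4 := by
    have := sG f
    rw [hF1, hGf, map_smul, LinearMap.smul_apply, hXs] at this
    exact this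
  have GF2 : b F2 F2 = q • X 5 := by
    have := sG F1
    rw [hF2, GF1, map_smul, LinearMap.smul_apply, hXs] at this
    exact this
  -- right multiplication by `F1`
  have C1 : b (X 1) F1 = (μ - p) • X 3 := by
    have := sC x
    rw [hCx, hGx] at this
    simp only [map_add, map_smul, LinearMap.add_apply, LinearMap.smul_apply, hXs, hF3] at this
    rw [hX1, this]; module
  have Cs : ∀ k : ℕ, b (X (k + 1)) F1 = (μ - ((k : ℂ) + 1) * p) • X (k + 3) := by
    intro k
    induction k with
    | zero => rw [C1]; simp
    | succ k ih =>
      rw [← hXs (k + 1), sC, ih, Gs]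
      simp only [map_smul, LinearMap.smul_apply, hXs]
      push_cast
      module
  have CF1 : b F1 F1 = (ρ - q) • X 3 := by
    have := sC f
    rw [hF1, hCf, hGf] at this
    simp only [map_add, map_smul, LinearMap.add_apply, LinearMap.smul_apply, hXs, hF3] at this
    rw [this]; module
  have CF2 : b F2 F1 = (ρ - 2 * q) • X 4 := by
    have := sC F1
    rw [hF2, CF1, GF1] at this
    simp only [map_smul, LinearMap.smul_apply, hXs] at this
    rw [this]; module
  -- The recursion for `R_F1` continued past the end of the `f`-chain must give zero; likewise for
  -- `R_f` and `g` below.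
  have hρ : ρ = 3 * q := by
    have := sC F2
    rw [hF3, CF2, GF2] at this
    simp only [map_smul, LinearMap.smul_apply, hXs, map_zero, LinearMap.zero_apply] at this
    have h0 := hXne (c := ρ - 3 * q) (le_refl 5) (by linear_combination (norm := module) -this)
    linear_combination h0
  -- right multiplication by `f`
  have B1 : b (X 1) f = (a - μ) • X 2 + (β - ν) • F2 := by
    have := sB x
    rw [hBx, hCx] at this
    simp only [map_add, map_smul, LinearMap.add_apply, LinearMap.smul_apply, hXs, hF2] at this
    rw [hX1, this]; module
  have B2 : b (X 2) f = (a - 2 * μ + p) • X 3 := by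
    have := sB (X 1)
    rw [B1, C1] at this
    simp only [map_add, map_smul, LinearMap.add_apply, LinearMap.smul_apply, hXs, hF3] at this
    rw [this]; module
  have B3 : b (X 3) f = (a - 3 * μ + 3 * p) • X 4 := by
    have := sB (X 2)
    rw [B2, Cs 1] at this
    simp only [map_smul, LinearMap.smul_apply, hXs] at this
    rw [this]; push_cast; module
  have B4 : b (X 4) f = (a - 4 * μ + 6 * p) • X 5 := by
    have := sB (X 3)
    rw [B3, Cs 2] at this
    simp only [map_smul, LinearMap.smul_apply, hXs] at this
    rw [this]; push_cast; module
  have BF1 : b F1 f = (g - 3 * q) • X 2 + (δ - σ) • F2 := by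
    have := sB f
    rw [hF1, hBf, hCf, hρ] at this
    simp only [map_add, map_smul, LinearMap.add_apply, LinearMap.smul_apply, hXs, hF2] at this
    rw [this]; module
  have BF2 : b F2 f = (g - 5 * q) • X 3 := by
    have := sB F1
    rw [hF2, BF1, CF1, hρ] at this
    simp only [map_add, map_smul, LinearMap.add_apply, LinearMap.smul_apply, hXs, hF3] at this
    rw [this]; module
  have hg : g = 6 * q := by
    have := sB F2
    rw [hF3, BF2, CF2, hρ] at this
    simp only [map_smul, LinearMap.smul_apply, hXs, map_zero, LinearMap.zero_apply] at this
    have h0 := hXne (c := g - 6 * q) (show 4 ≤ 5 by norm_num)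
      (by linear_combination (norm := module) -this)
    linear_combination h0
  -- `F2` lies in the right annihilator
  have hG : ∀ u, b u F2 = 0 := by
    by_contra! hne
    obtain ⟨u, hu⟩ := hne
    have hν : ν = -1 := by
      have := (smul_eq_zero.1 (T3 u)).resolve_right hu
      linear_combination this
    obtain ⟨u', hu'⟩ : ∃ u', b u' F1 ≠ 0 := by
      by_contra! h0
      apply hu
      have := sC u
      rw [h0, h0] at this
      simpa using this.symm
    have hβ : β = -1 := by
      have := (smul_eq_zero.1 (T2 u')).resolve_right hu'
      linear_combination this
    have hδ : δ = 0 := (smul_eq_zero.1 (T1 u')).resolve_right hu'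
    subst hβ hν hδ hg hρ
    have E1 : q = 3 * p * μ - 3 * p ^ 2 := by
      have := T5 x
      rw [hBx, hGx] at this
      simp only [map_add, map_smul, LinearMap.add_apply, LinearMap.smul_apply, Gs, GF1, B3] at this
      have h0 := hXne (c := a * p - q - p * (a - 3 * μ + 3 * p)) (show 4 ≤ 5 by norm_num)
        (by linear_combination (norm := module) this)
      linear_combination -h0
    have E2 : p * (μ - 2 * p) = 0 := by
      have := T5 (X 1)
      rw [B1, Gs] at this
      simp only [map_add, map_smul, LinearMap.add_apply, LinearMap.smul_apply, Gs, GF2, B4] at this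
      have h0 := hXne (c := (a - μ) * p - p * (a - 4 * μ + 6 * p)) (le_refl 5)
        (by linear_combination (norm := module) this)
      linear_combination h0 / 3
    -- With `p = 0` also `q = 0`, so the kernel of `R_F2` contains both generators and is
    -- `R_x`-stable, hence is everything.
    have hp : p ≠ 0 := by
      rintro rfl
      have hq : q = 0 := by rw [E1]; ring
      subst hq
      apply hu
      have hS : LinearMap.ker (rightMul b F2) = ⊤ := by
        refine h.gen _ ?_ ?_ fun v hv => ?_
        · rw [LinearMap.mem_ker, rightMul_apply, hGx, zero_smul]
        · rw [LinearMap.mem_ker, rightMul_apply, hGf, zero_smul]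
        · rw [LinearMap.mem_ker, rightMul_apply] at hv ⊢
          rw [sG, hv, map_zero, LinearMap.zero_apply]
      exact LinearMap.mem_ker.1 (hS.ge (Submodule.mem_top (x := u)))
    have hμ : μ = 2 * p := by
      have := (mul_eq_zero.1 E2).resolve_left hp
      linear_combination this
    subst hμ
    have hq : q = 3 * p ^ 2 := by rw [E1]; ring
    have hq0 : q ≠ 0 := by rw [hq]; exact mul_ne_zero three_ne_zero (pow_ne_zero 2 hp)
    have ha : a = 9 * p := by
      have := T5 f
      rw [hBf, hGf] at this
      simp only [map_add, map_smul, LinearMap.add_apply, LinearMap.smul_apply, Gs, GF1, B3] at this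
      have h0 := hXne (c := q * (6 * p - (a - 3 * (2 * p) + 3 * p))) (show 4 ≤ 5 by norm_num)
        (by linear_combination (norm := module) this)
      have := (mul_eq_zero.1 h0).resolve_left hq0
      linear_combination -this
    subst ha
    have hσ : σ = -4 * p := by
      have := T5 F1
      rw [BF1, GF1] at this
      simp only [map_add, map_smul, LinearMap.add_apply, LinearMap.smul_apply, Gs, GF2, B4] at this
      have h0 := hXne (c := q * (3 * p - σ - (9 * p - 4 * (2 * p) + 6 * p))) (le_refl 5)
        (by linear_combination (norm := module) this)
      have := (mul_eq_zero.1 h0).resolve_left hq0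
      linear_combination -this
    have h4 := T4 x
    rw [hBx, hCx, hGx] at h4
    simp only [map_add, map_smul, LinearMap.add_apply, LinearMap.smul_apply, C1, CF1, B2,
      BF2] at h4
    have h0 := hXne (c := 9 * p * (2 * p - p) - (3 * q - q)
        - (2 * p * (9 * p - 2 * (2 * p) + p) - (6 * q - 5 * q)) - σ * p) (show 3 ≤ 5 by norm_num)
      (by linear_combination (norm := module) h4)
    rw [hσ, hq] at h0
    apply hp
    have : p ^ 2 = 0 := by linear_combination -h0 / 2
    exact pow_eq_zero_iff two_ne_zero |>.1 this
  have hp0 : p = 0 := by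
    have := hG x
    rw [hGx] at this
    exact hXne (by norm_num) this
  have hq0 : q = 0 := by
    have := hG f
    rw [hGf] at this
    exact hXne (by norm_num) this
  subst hp0 hq0
  simp only [mul_zero] at hρ hg
  subst hρ hg
  -- With `p = q = 0`, `T4` at `x` reduces to `2μ² X 3 = 0`.
  have hμ : μ = 0 := by
    have := T4 x
    rw [hBx, hCx, hG] at this
    simp only [map_add, map_smul, LinearMap.add_apply, LinearMap.smul_apply, C1, CF1, B2,
      BF2] at this
    have h0 := hXne (c := 2 * μ ^ 2) (show 3 ≤ 5 by norm_num)
      (by linear_combination (norm := module) this)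
    simpa using h0
  subst hμ
  rw [zero_smul, zero_add] at hBf hCx hCf
  have hF2c : ∀ {c : ℂ}, c • F2 = 0 → c = 0 := fun hc =>
    (smul_eq_zero.1 hc).resolve_right hF2ne
  refine ⟨⟨a, β, δ, ν, σ⟩, ⟨hF2c ?_, hF2c ?_, hF2c ?_, hF2c ?_⟩,
    ⟨hb, h.gen, h.pow_x, h.pow_f, ?_, ?_, ?_, ?_, ?_⟩⟩
  · simpa [hCx, smul_smul] using T1 x
  · simpa [hCf, smul_smul] using T1 f
  · simpa [hCx, smul_smul] using T2 x
  · simpa [hCf, smul_smul] using T2 f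
  · rw [hF1, hBx, hX1]
  · rw [hF1, hBf]
  · rw [hF1, hF2, hCx]
  · rw [hF1, hF2, hCf]
  · rw [hF1, hF2]; exact hG

end HomogeneousGenerators

/-- It suffices to check the chain vectors: for the long chain this is the vanishing of right
multiplication by `R_x`-powers of `x`, and for the short one the only nonzero case is `f3`. Holding
for every `u`, it applies to the `e_{n-2}` of an arbitrary basis of the first type without comparing
it with `f`. -/
theorem Presentation.sq_right_eq_zero {x f : L} {P : Params} (h : Presentation n b x f P)
    (u v : L) : b v (b (b u x) x) = 0 := by
  have key : (⨅ v : L, LinearMap.ker (b v ∘ₗ rightMul b x ∘ₗ rightMul b x)) = ⊤ := by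
    refine chain_span h.gen (fun k => ?_) fun k => ?_
    · simp only [Submodule.mem_iInf, LinearMap.mem_ker, LinearMap.comp_apply, rightMul_apply]
      intro v
      rw [← rightMul_pow_succ, ← rightMul_pow_succ]
      exact bracket_pow_succ_eq_zero h.leibniz v x (k + 1)
    · simp only [Submodule.mem_iInf, LinearMap.mem_ker, LinearMap.comp_apply, rightMul_apply]
      intro v
      rw [← rightMul_pow_succ, ← rightMul_pow_succ]
      match k with
      | 0 => simpa [pow_succ, rightMul_apply] using h.f3 v
      | k + 1 => rw [h.pow_f_of_le (by omega), map_zero]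
  have h1 := key.ge (Submodule.mem_top (x := u))
  simp only [Submodule.mem_iInf, LinearMap.mem_ker, LinearMap.comp_apply, rightMul_apply] at h1
  exact h1 v

end Structure

end NatGradedLeibniz

end

/-! ### The classification theorem -/

theorem theorem2p2 (n : ℕ) (hn : 9 ≤ n) :
    -- every algebra of the first type is isomorphic to a listed one, and in every basis
    -- of the first type the last vector lies in the right annihilator
    (∀ (L : Type*) [AddCommGroup L] [Module ℂ L] (b : L →ₗ[ℂ] L →ₗ[ℂ] L),
      Module.finrank ℂ L = n → IsFirstType n b →
        (∃ p : Label, p.Admissible ∧ Isomorphic b (p.algebra n)) ∧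
        ∀ e : Module.Basis (Fin n) ℂ L, IsFirstTypeBasis b e →
          vec e n ∈ rightAnnihilator b) ∧
    -- every listed algebra is of the first type
    (∀ p : Label, p.Admissible → IsFirstType n (p.algebra n)) ∧
    -- the listed algebras are pairwise non-isomorphic
    (∀ p q : Label, p.Admissible → q.Admissible →
      Isomorphic (p.algebra n) (q.algebra n) → p = q) := by
  refine ⟨fun L _ _ b hdim hb => ?_, fun p _ => ?_, fun p q hp hq h => ?_⟩
  · obtain ⟨hng, -, e₀, he₀⟩ := hb
    refine ⟨?_, fun e he => ?_⟩
    · obtain ⟨D, x, f, hxf, -⟩ := he₀.exists_homogeneousGenerators hn hng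
      obtain ⟨Q, hQ, hpres⟩ := hxf.exists_presentation hn hdim
      obtain ⟨p, hp, s, d, hrel⟩ := hQ.exists_label
      refine ⟨p, hp, ?_⟩
      rw [p.algebra_eq_model hn]
      exact (hpres.change_generators hn hdim hrel).isomorphic_model hn hdim
    · obtain ⟨D, x, f, hxf, hx⟩ := he.exists_homogeneousGenerators hn hng
      obtain ⟨Q, hQ, hpres⟩ := hxf.exists_presentation hn hdim
      -- `R_x = R_{e_1}` for the basis at hand, so its last vector is a double right multiple by
      -- `x`.
      have hlast : vec e n = b (b (vec e (n - 2)) x) x := by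
        rw [hx, hx, he.bracket (by omega) (by omega) (by omega),
          he.bracket (by omega) (by omega) (by omega)]
        congr 1; omega
      rw [hlast]
      exact fun y => hpres.sq_right_eq_zero _ y
  · rw [p.algebra_eq_model hn]
    exact isFirstType_model hn p.good_params
  · rw [p.algebra_eq_model hn, q.algebra_eq_model hn] at h
    obtain ⟨s, d, hrel⟩ := related_of_isomorphic hn h
    exact Label.eq_of_related hp hq hrel
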